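/- Let $0<q\le p<1/2$, and consider the myopic binary adversarial channel $\mathrm{MBAC}_{p,q}$ with block length $n$: the transmitter sends $\mathbf x\in\mathbb F_2^n$; an adversary observes $\mathbf z$, the output of a memoryless binary symmetric channel $\mathrm{BSC}(q)$ with input $\mathbf x$, and, after seeing all of $\mathbf z$, selects a state $\mathbf s\in\mathbb F_2^n$ according to a conditional distribution $J(\mathbf s\mid\mathbf z)$ of its choice, which may depend on the code; the receiver observes $\mathbf y$, the output of a memoryless $\mathrm{BSC}(p)$ with input $\mathbf x\oplus\mathbf s$ (given $\mathbf x$ and $\mathbf s$, the output $\mathbf y$ is independent of $\mathbf z$). The state $\mathbf s_0=\mathbf 0$ represents the absence of the adversary. An $(M,n)$ authentication code consists of a stochastic encoder, which encodes each message $i\in\{1,\dots,M\}$ as a random $\mathbf X\in\mathbb F_2^n$ with distribution $P(\mathbf x\mid i)$, and a decoder $\phi:\mathbb F_2^n\to\{0,1,\dots,M\}$, where $0$ declares adversarial interference. For a message $i$ and an adversary $J$ let $$e(i,J)=\Pr\big[(\mathbf s=\mathbf s_0\text{ and }\phi(\mathbf y)\ne i)\text{ or }(\mathbf s\ne\mathbf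 s_0\text{ and }\phi(\mathbf y)\notin\{i,0\})\big],$$ the probability being over the encoder, both channels and $J$, and let $e(J)=\frac1M\sum_{i=1}^M e(i,J)$ and $e_{\max}(J)=\max_i e(i,J)$. A rate $R\ge 0$ is achievable under the average (respectively maximal) error criterion if there are $(\lceil 2^{nR}\rceil,n)$ authentication codes, $n\in\mathbb N$, with $\sup_J e(J)\to0$ (respectively $\sup_J e_{\max}(J)\to 0$) as $n\to\infty$. The authentication capacity $C_{\mathrm{auth}}$ under a criterion is the supremum of the rates achievable under it. Then, under the average error criterion and also under the maximal error criterion, $$C_{\mathrm{auth}}=1-H(p),\qquad H(p)=-p\log_2 p-(1-p)\log_2(1-p).$$ -/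

import Mathlib

open Filter Topology

noncomputable section

namespace MyopicAuth

/-- A conditional distribution `P(b ∣ a)` on a finite alphabet `B` given `a : A`. -/
structure CondDist (A B : Type) [Fintype B] where
  prob : A → B → ℝ
  nonneg : ∀ a b, 0 ≤ prob a b
  sum_one : ∀ a, ∑ b, prob a b = 1

/-- The memoryless extension to blocks of length `n`: `P(𝐛 ∣ 𝐚) = ∏ k, P(bₖ ∣ aₖ)`. -/
def CondDist.block {A B : Type} [Fintype B] (P : CondDist A B) (n : ℕ) :
    CondDist (Fin n → A) (Fin n → B) where
  prob a b := ∏ k, P.prob (a k) (b k)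
  nonneg a b := Finset.prod_nonneg fun k _ => P.nonneg (a k) (b k)
  sum_one a := by
    rw [← Fintype.prod_sum fun k b => P.prob (a k) b]
    simp [P.sum_one]

/-- A discrete memoryless adversarial channel `W(y ∣ x, s)` with no-adversary state `s₀`, together
with the discrete memoryless channel `U(z ∣ x)` through which the adversary observes the input. -/
structure MyopicChannel (X S Y Z : Type) [Fintype Y] [Fintype Z] where
  W : CondDist (X × S) Y
  U : CondDist X Z
  s₀ : S

/-- An `(M, n)` authentication code: the stochastic encoder generates `𝐱` according to
`enc.prob i 𝐱 = P(𝐱 ∣ i)`; the decoder outputs a message or `none`, which declares adversarial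
interference. -/
structure AuthCode (X Y : Type) [Fintype X] (M n : ℕ) where
  enc : CondDist (Fin M) (Fin n → X)
  dec : (Fin n → Y) → Option (Fin M)

section

variable {X S Y Z : Type} [Fintype X] [Fintype S] [DecidableEq S] [Fintype Y] [Fintype Z]
variable {M n : ℕ}

/-- `W(φ⁻¹(D) ∣ 𝐱, 𝐬)`: the probability that the decoder output lies in `D` when `𝐱` is sent and
the state sequence is `𝐬`. -/
def decProb (ch : MyopicChannel X S Y Z) (c : AuthCode X Y M n) (D : Finset (Option (Fin M)))
    (x : Fin n → X) (s : Fin n → S) : ℝ :=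
  ∑ y with c.dec y ∈ D, (ch.W.block n).prob (fun k => (x k, s k)) y

/-- The probability of error `e(i, J)` when message `i` is sent and the adversary uses
`J(𝐬 ∣ 𝐳)`. If the state is the constant sequence `𝐬₀`, every output other than `i` is an error;
otherwise every output other than `i` and `none` is an error. -/
def errorProb (ch : MyopicChannel X S Y Z) (c : AuthCode X Y M n)
    (J : CondDist (Fin n → Z) (Fin n → S)) (i : Fin M) : ℝ :=
  ∑ x, c.enc.prob i x *
    ((∑ z, (ch.U.block n).prob x z * J.prob z (fun _ => ch.s₀)
        * decProb ch c {some i}ᶜ x (fun _ => ch.s₀))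
      + ∑ s ∈ {fun _ => ch.s₀}ᶜ, ∑ z, (ch.U.block n).prob x z * J.prob z s
        * decProb ch c {some i, none}ᶜ x s)

/-- The average error probability `e(J)` over equiprobable messages. -/
def avgError (ch : MyopicChannel X S Y Z) (c : AuthCode X Y M n)
    (J : CondDist (Fin n → Z) (Fin n → S)) : ℝ :=
  (1 / (M : ℝ)) * ∑ i, errorProb ch c J i

/-- The maximal error probability `e_max(J)` over all messages. -/
def maxError (ch : MyopicChannel X S Y Z) (c : AuthCode X Y M n)
    (J : CondDist (Fin n → Z) (Fin n → S)) : ℝ :=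
  ⨆ i, errorProb ch c J i

/-- The number `⌈2 ^ (n R)⌉` of messages of a code of rate `R` and block length `n`. -/
def numMessages (R : ℝ) (n : ℕ) : ℕ := ⌈(2 : ℝ) ^ ((n : ℝ) * R)⌉₊

/-- `R` is achievable under the average error criterion. -/
def AchievableAvg (ch : MyopicChannel X S Y Z) (R : ℝ) : Prop :=
  0 ≤ R ∧ ∃ c : (n : ℕ) → AuthCode X Y (numMessages R n) n,
    Tendsto (fun n => ⨆ J : CondDist (Fin n → Z) (Fin n → S), avgError ch (c n) J) atTop (𝓝 0)

/-- `R` is achievable under the maximal error criterion. -/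
def AchievableMax (ch : MyopicChannel X S Y Z) (R : ℝ) : Prop :=
  0 ≤ R ∧ ∃ c : (n : ℕ) → AuthCode X Y (numMessages R n) n,
    Tendsto (fun n => ⨆ J : CondDist (Fin n → Z) (Fin n → S), maxError ch (c n) J) atTop (𝓝 0)

/-- The (average error) authentication capacity is `C`. -/
def IsAuthCapacityAvg (ch : MyopicChannel X S Y Z) (C : ℝ) : Prop :=
  IsLUB {R | AchievableAvg ch R} C

/-- The maximal error authentication capacity is `C`. -/
def IsAuthCapacityMax (ch : MyopicChannel X S Y Z) (C : ℝ) : Prop :=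
  IsLUB {R | AchievableMax ch R} C

end

/-- The binary symmetric channel with crossover probability `p`. -/
def bsc (p : unitInterval) : CondDist (ZMod 2) (ZMod 2) where
  prob x y := if y = x then 1 - (p : ℝ) else (p : ℝ)
  nonneg x y := by
    split_ifs
    · exact sub_nonneg.mpr p.2.2
    · exact p.2.1
  sum_one x := by
    have h : (Finset.univ : Finset (ZMod 2)) = {0, 1} := rfl
    rw [h, Finset.sum_pair (by decide)]
    obtain rfl | rfl : x = 0 ∨ x = 1 := by revert x; decide
    · simp
    · simp

/-- The myopic binary adversarial channel with parameters `p` and `q`: the receiver sees `x + s`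
through a BSC(`p`), the adversary sees `x` through a BSC(`q`), and the no-adversary state is `0`. -/
def mbac (p q : unitInterval) : MyopicChannel (ZMod 2) (ZMod 2) (ZMod 2) (ZMod 2) where
  W :=
    { prob := fun xs y => (bsc p).prob (xs.1 + xs.2) y
      nonneg := fun xs y => (bsc p).nonneg (xs.1 + xs.2) y
      sum_one := fun xs => (bsc p).sum_one (xs.1 + xs.2) }
  U := bsc q
  s₀ := 0

/-- The binary entropy function, in bits. -/
def binEntropyBits (p : ℝ) : ℝ := Real.binEntropy p / Real.log 2

end MyopicAuth

end

namespace MyopicAuth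

open Finset

variable {n : ℕ}

/-! Converse: an adversary that never interferes leaves an ordinary BSC(`p`), and the maximal
criterion is the stronger one, so it suffices to bound the average error against `idle`. By sphere
packing, the output has at least `(p - η) n` errors except with exponentially small probability, and
every such word has weight at most `(1 - p)^n l^((p - η) n)`, where `l = p / (1 - p)`. The disjoint
decoding sets contain at most `2^n` words, so above `1 - H(p)` the average error even tends to 1
(`le_avgError_idle`).

Achievability: the encoder sends a random codeword and adds artificial BSC(`δ`) noise at a
message-dependent set `B i` of positions. Since `q > 0`, the adversary cannot resolve this noise.
Given `z` and whatever `s` it chooses, each received bit differs from any prescribed bit with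
conditional probability at least `p`, and at least `p + (1 - 2p) δ q` on `B i` (`le_attackWeight`).
To pass for message `j`, the output would need an error rate near `p` off `B j`, which the surplus
on `B i \ B j` prevents. A constant-weight Gilbert–Varshamov family provides exponentially many sets
with every `B i \ B j` of linear size (`exists_patterns`).

The Chernoff exponent of this test is too small for a union bound over exponentially many `j`.
Therefore the block is cut into `K` parts. For each part, the outputs outside it single out at most
one candidate `j`, and the test for `j` uses only outputs inside it, which are conditionally
independent of the others. Some part carries a fraction `1 / K` of `B i \ B j`, so a union over `K`
parts suffices (`undetected_le`). Decoding from the complement of a part, with noise level at most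
`p + δ`, costs a rate that vanishes as `K` grows and `δ` shrinks; random coding and expurgation then
give every rate below `1 - H(p)`, even for the maximal error (`exists_authCode`,
`achievableMax_of_lt`). -/

theorem ZMod.two_eq_or (c b : ZMod 2) : b = c ∨ b = c + 1 := by
  revert b c; decide

theorem ZMod.two_ne_add_one (c : ZMod 2) : c ≠ c + 1 := by
  revert c; decide

theorem sum_zmod_two (c : ZMod 2) (f : ZMod 2 → ℝ) : ∑ b, f b = f c + f (c + 1) := by
  have h : (univ : Finset (ZMod 2)) = {c, c + 1} := by revert c; decide
  rw [h, sum_pair (ZMod.two_ne_add_one c)]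

/-! ### Exponential tilting, tail bounds and Hamming volumes -/

/-- The number of positions in `T` where `y` differs from `c`. -/
def errs (T : Finset (Fin n)) (c y : Fin n → ZMod 2) : ℕ := #{k ∈ T | y k ≠ c k}

/-- `θ ^ errs` as a product over all coordinates. -/
theorem pow_errs (θ : ℝ) (T : Finset (Fin n)) (c y : Fin n → ZMod 2) :
    θ ^ errs T c y = ∏ k, if k ∈ T ∧ y k ≠ c k then θ else 1 := by
  rw [errs, ← prod_const, prod_filter, ← prod_filter_mul_prod_filter_not univ (· ∈ T)]
  rw [prod_congr (s₁ := filter (fun x => x ∉ T) univ) rfl (g := fun _ => (1 : ℝ))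
    (by intro x hx; simp at hx; simp [hx])]
  simp only [prod_const_one, mul_one, filter_mem_eq_inter, univ_inter]
  refine prod_congr rfl fun k hk => ?_
  simp [hk]

theorem sum_prod_eq (g : Fin n → ZMod 2 → ℝ) : ∑ y : Fin n → ZMod 2, ∏ k, g k (y k) = ∏ k, ∑ b, g k b :=
  (Fintype.prod_sum g).symm

/-- Exponential tilting of a product weight at the errors in `T`. -/
def tilt (θ : ℝ) (T : Finset (Fin n)) (c : Fin n → ZMod 2) (g : Fin n → ZMod 2 → ℝ) :
    Fin n → ZMod 2 → ℝ :=
  fun k b => (if k ∈ T ∧ b ≠ c k then θ else 1) * g k b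

theorem sum_tilt (θ : ℝ) (T : Finset (Fin n)) (c : Fin n → ZMod 2) (g : Fin n → ZMod 2 → ℝ)
    (k : Fin n) : ∑ b, tilt θ T c g k b
      = if k ∈ T then (∑ b, g k b) - (1 - θ) * g k (c k + 1) else ∑ b, g k b := by
  split_ifs with h
  · rw [sum_zmod_two (c k), sum_zmod_two (c k)]
    simp [tilt, h]
    ring
  · simp [tilt, h]

theorem prod_tilt (θ : ℝ) (T : Finset (Fin n)) (c : Fin n → ZMod 2) (g : Fin n → ZMod 2 → ℝ)
    (y : Fin n → ZMod 2) : ∏ k, tilt θ T c g k (y k) = θ ^ errs T c y * ∏ k, g k (y k) := by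
  simp only [tilt, prod_mul_distrib, pow_errs]

/-- If `F` does not depend on the coordinates in `S`, its sum against a product weight depends on the
factors in `S` only through their total masses. -/
theorem exists_sum_mul_prod_eq (S : Finset (Fin n)) (F : (Fin n → ZMod 2) → ℝ) (hF : ∀ y, 0 ≤ F y)
    (hS : ∀ y y', (∀ k ∉ S, y k = y' k) → F y = F y') (g : Fin n → ZMod 2 → ℝ)
    (hg : ∀ k b, 0 ≤ g k b) :
    ∃ G : ℝ, 0 ≤ G ∧ ∀ g' : Fin n → ZMod 2 → ℝ, (∀ k ∉ S, g' k = g k) →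
      ∑ y, F y * ∏ k, g' k (y k) = (∏ k ∈ S, ∑ b, g' k b) * G := by
  classical
  let e := (Equiv.piEquivPiSubtypeProd (fun k => k ∈ S) (fun _ : Fin n => ZMod 2)).symm
  -- The coordinates in `S` are set to 0, which is harmless because `F` ignores them. This constant
  -- is the same for all weights agreeing with `g` off `S`, so it cancels when tilted and untilted
  -- sums are compared.
  refine ⟨∑ b : {k // k ∉ S} → ZMod 2, F (e (0, b)) * ∏ k : {k // k ∉ S}, g k (b k), ?_, ?_⟩
  · exact sum_nonneg fun b _ => mul_nonneg (hF _) (prod_nonneg fun k _ => hg _ _)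
  intro g' hg'
  rw [← e.sum_comp, Fintype.sum_prod_type]
  have h1 : ∀ a b, F (e (a, b)) * ∏ k, g' k (e (a, b) k)
      = (∏ k : {k // k ∈ S}, g' k (a k)) * (F (e (0, b)) * ∏ k : {k // k ∉ S}, g k (b k)) := by
    intro a b
    rw [hS (e (a, b)) (e (0, b)) (by intro k hk; simp [e, hk]),
      ← prod_mul_prod_compl S, ← prod_coe_sort S,
      prod_subtype Sᶜ (p := fun k => k ∉ S) (fun _ => mem_compl)]
    have h2 : ∏ i : {k // k ∈ S}, g' i (e (a, b) i) = ∏ k : {k // k ∈ S}, g' k (a k) :=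
      prod_congr rfl fun i _ => by simp [e, i.2]
    have h3 : ∏ i : {k // k ∉ S}, g' i (e (a, b) i) = ∏ k : {k // k ∉ S}, g k (b k) :=
      prod_congr rfl fun i _ => by simp [e, i.2, hg' _ i.2]
    rw [h2, h3]; ring
  simp only [h1, ← sum_mul_sum]
  rw [← Fintype.prod_sum, ← prod_coe_sort S (fun k => ∑ b, g' k b)]

theorem prod_one_add_le_exp {ι : Type*} (S : Finset ι) (f : ι → ℝ) (hf : ∀ k ∈ S, 0 ≤ 1 + f k) :
    ∏ k ∈ S, (1 + f k) ≤ Real.exp (∑ k ∈ S, f k) := by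
  rw [Real.exp_sum]
  exact prod_le_prod hf fun k _ => by linarith [Real.add_one_le_exp (f k)]

/-- The bound `log θ ≥ 1 - 1/θ` makes the simple choice `θ = 1 + η/2` good enough; an optimal tilt
would only improve the constant `1/6`. -/
theorem chernoff_upper_exponent {θ : ℝ} {η A m : ℝ} (hη : 0 < η) (hη1 : η ≤ 1) (hA : 0 ≤ A) (hAn : A ≤ m)
    (hθ : θ = 1 + η / 2) :
    θ ^ (-(A + η * m)) * Real.exp ((θ - 1) * A) ≤ Real.exp (-(η ^ 2 / 6) * m) := by
  have hθ0 : 0 < θ := by rw [hθ]; positivity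
  have hm : 0 ≤ m := hA.trans hAn
  rw [Real.rpow_def_of_pos hθ0, ← Real.exp_add, Real.exp_le_exp]
  have h1 : 1 - θ⁻¹ ≤ Real.log θ := Real.one_sub_inv_le_log_of_pos hθ0
  have h2 : (η / 2) / θ = 1 - θ⁻¹ := by rw [hθ]; field_simp; ring
  have h3 : (η/2)/θ * (A + η * m) ≤ Real.log θ * (A + η * m) := by
    rw [h2]; exact mul_le_mul_of_nonneg_right h1 (by positivity)
  have h4 : (η / 2) * A + η ^ 2 / 6 * m ≤ (η/2)/θ * (A + η * m) := by
    rw [div_mul_eq_mul_div (η / 2), le_div_iff₀ hθ0, hθ]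
    nlinarith [mul_nonneg (sq_nonneg η) (sub_nonneg.2 hAn), mul_nonneg (mul_nonneg (sq_nonneg η) hm) (sub_nonneg.2 hη1)]
  have h5 : (θ - 1) * A = η / 2 * A := by rw [hθ]; ring
  rw [h5]; linarith

/-- With the reciprocal tilt, `-log θ ≤ η/2` and `1 - θ ≥ η/3`; the gap `A' - A (1 + η/2)` is at
least `η m / 2`, and the product of the last two bounds is the exponent. -/
theorem chernoff_lower_exponent {θ : ℝ} {η A A' m : ℝ} (hη : 0 < η) (hη1 : η ≤ 1) (hA : 0 ≤ A) (hAn : A ≤ m)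
    (hA' : A + η * m ≤ A') (hθ : θ = (1 + η / 2)⁻¹) :
    θ ^ (-A) * Real.exp (-(1 - θ) * A') ≤ Real.exp (-(η ^ 2 / 6) * m) := by
  have hθ0 : 0 < θ := by rw [hθ]; positivity
  have hm : 0 ≤ m := hA.trans hAn
  rw [Real.rpow_def_of_pos hθ0, ← Real.exp_add, Real.exp_le_exp]
  have h1 : 1 - θ⁻¹ ≤ Real.log θ := Real.one_sub_inv_le_log_of_pos hθ0
  have h2 : 1 - θ⁻¹ = -(η / 2) := by rw [hθ, inv_inv]; ring
  rw [h2] at h1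
  have h3 : 1 - θ = (η / 2) / (1 + η / 2) := by rw [hθ]; field_simp; ring
  have h4 : η / 3 ≤ 1 - θ := by
    rw [h3, le_div_iff₀ (by positivity)]; nlinarith
  have h6 : (1 - θ) * (1 + η / 2) = η / 2 := by rw [h3]; field_simp
  have h7 : η * m / 2 ≤ A' - A * (1 + η / 2) := by nlinarith
  have h5 : η / 3 * (η * m / 2) ≤ (1 - θ) * (A' - A * (1 + η / 2)) := by
    apply mul_le_mul h4 h7 (by positivity) (by linarith)
  have h8 : (1 - θ) * (A' - A * (1 + η / 2)) = (1 - θ) * A' - η / 2 * A := by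
    linear_combination (-A) * h6
  nlinarith [mul_le_mul_of_nonneg_right h1 hA]

/-- Upper tail bound for the number of errors under a product distribution. -/
theorem sum_errs_gt_le (T : Finset (Fin n)) (c : Fin n → ZMod 2) (g : Fin n → ZMod 2 → ℝ)
    (hg : ∀ k b, 0 ≤ g k b) (hg1 : ∀ k, ∑ b, g k b = 1) {η A : ℝ} (hη : 0 < η) (hη1 : η ≤ 1)
    (hA : ∑ k ∈ T, g k (c k + 1) ≤ A) (hAn : A ≤ n) :
    ∑ y : Fin n → ZMod 2 with A + η * n < errs T c y, ∏ k, g k (y k) ≤ Real.exp (-(η ^ 2 / 6) * n) := by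
  have hA0 : 0 ≤ A := (sum_nonneg fun k _ => hg k _).trans hA
  obtain ⟨θ, hθ⟩ : ∃ θ, θ = 1 + η / 2 := ⟨_, rfl⟩
  have hθ1 : 1 ≤ θ := by rw [hθ]; linarith
  have hθ0 : 0 < θ := by linarith
  refine le_trans ?_ (chernoff_upper_exponent hη hη1 hA0 hAn hθ)
  calc ∑ y : Fin n → ZMod 2 with A + η * n < errs T c y, ∏ k, g k (y k)
      ≤ ∑ y : Fin n → ZMod 2 with A + η * n < errs T c y,
          θ ^ (-(A + η * n)) * ∏ k, tilt θ T c g k (y k) := by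
        refine sum_le_sum fun y hy => ?_
        rw [prod_tilt, ← mul_assoc]
        refine le_mul_of_one_le_left (prod_nonneg fun k _ => hg _ _) ?_
        rw [← Real.rpow_natCast, ← Real.rpow_add hθ0]
        apply Real.one_le_rpow hθ1
        simp only [mem_filter] at hy
        linarith [hy.2]
    _ ≤ ∑ y : Fin n → ZMod 2, θ ^ (-(A + η * n)) * ∏ k, tilt θ T c g k (y k) := by
        refine sum_le_sum_of_subset_of_nonneg (filter_subset _ _) fun y _ _ => ?_
        refine mul_nonneg (by positivity) (prod_nonneg fun k _ => ?_)
        unfold tilt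
        refine mul_nonneg ?_ (hg _ _)
        split_ifs <;> linarith
    _ = θ ^ (-(A + η * n)) * ∏ k ∈ T, (1 + (θ - 1) * g k (c k + 1)) := by
        rw [← mul_sum, sum_prod_eq]
        simp only [sum_tilt, hg1]
        congr 1
        rw [← prod_filter_mul_prod_filter_not univ (· ∈ T)]
        rw [prod_congr (s₁ := filter (fun x => x ∉ T) univ) rfl (g := fun _ => (1 : ℝ))
          (by intro x hx; simp at hx; simp [hx])]
        simp only [prod_const_one, mul_one, filter_mem_eq_inter, univ_inter]
        refine prod_congr rfl fun k hk => ?_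
        simp only [hk, if_true]; ring
    _ ≤ _ := by
        gcongr
        refine (prod_one_add_le_exp _ _ fun k _ => ?_).trans ?_
        · have := hg k (c k + 1); nlinarith
        · rw [← mul_sum]; gcongr

/-- Lower tail bound for the number of errors in `T ⊆ S` under a product weight, jointly with an
event that does not depend on the coordinates in `S`. -/
theorem sum_mul_errs_le_le (S T : Finset (Fin n)) (hTS : T ⊆ S) (c : Fin n → ZMod 2)
    (g : Fin n → ZMod 2 → ℝ) (hg : ∀ k b, 0 ≤ g k b)
    (F : (Fin n → ZMod 2) → ℝ) (hF : ∀ y, 0 ≤ F y)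
    (hS : ∀ y y', (∀ k ∉ S, y k = y' k) → F y = F y')
    (a : Fin n → ℝ) (ha : ∀ k, a k ≤ 1)
    (hga : ∀ k, a k * ∑ b, g k b ≤ g k (c k + 1))
    {η A : ℝ} (hη : 0 < η) (hη1 : η ≤ 1)
    (hA0 : 0 ≤ A) (hAn : A ≤ n) (hA : A + η * n ≤ ∑ k ∈ T, a k) :
    ∑ y, (if (errs T c y : ℝ) ≤ A then F y * ∏ k, g k (y k) else 0)
      ≤ Real.exp (-(η ^ 2 / 6) * n) * ∑ y, F y * ∏ k, g k (y k) := by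
  obtain ⟨θ, hθ⟩ : ∃ θ, θ = (1 + η / 2)⁻¹ := ⟨_, rfl⟩
  have hθ0 : 0 < θ := by rw [hθ]; positivity
  have hθ1 : θ ≤ 1 := by rw [hθ]; exact inv_le_one_of_one_le₀ (by linarith)
  obtain ⟨G, hG0, hG⟩ := exists_sum_mul_prod_eq S F hF hS g hg
  have htilt0 : ∀ k b, 0 ≤ tilt θ T c g k b := by
    intro k b
    unfold tilt
    refine mul_nonneg ?_ (hg _ _)
    split_ifs <;> linarith
  have hZ : ∀ k, 0 ≤ ∑ b, g k b := fun k => sum_nonneg fun b _ => hg k b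
  -- The weights need not be normalised: each tilted coordinate is compared with its own total mass,
  -- so the final bound is relative, that is, conditional.
  have h1 : ∏ k ∈ S, ∑ b, tilt θ T c g k b
      ≤ Real.exp (-(1 - θ) * ∑ k ∈ T, a k) * ∏ k ∈ S, ∑ b, g k b := by
    have : ∀ k ∈ S, ∑ b, tilt θ T c g k b
        ≤ (if k ∈ T then 1 + -(1 - θ) * a k else 1) * ∑ b, g k b := by
      intro k _
      rw [sum_tilt]
      split_ifs
      · nlinarith [hga k]
      · simp
    refine (prod_le_prod (fun k _ => sum_nonneg fun b _ => htilt0 k b) this).trans ?_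
    rw [prod_mul_distrib]
    refine mul_le_mul_of_nonneg_right ?_ (prod_nonneg fun k _ => hZ k)
    rw [prod_ite, prod_const_one, mul_one, filter_mem_eq_inter, inter_eq_right.2 hTS, mul_sum]
    refine prod_one_add_le_exp _ _ fun k _ => ?_
    nlinarith [ha k]
  calc ∑ y, (if (errs T c y : ℝ) ≤ A then F y * ∏ k, g k (y k) else 0)
      ≤ ∑ y, θ ^ (-A) * (F y * ∏ k, tilt θ T c g k (y k)) := by
        refine sum_le_sum fun y _ => ?_
        split_ifs with h
        · rw [prod_tilt]
          have h0 : 0 ≤ F y * ∏ k, g k (y k) := mul_nonneg (hF y) (prod_nonneg fun k _ => hg _ _)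
          have h2 : 1 ≤ θ ^ (-A) * θ ^ errs T c y := by
            rw [← Real.rpow_natCast, ← Real.rpow_add hθ0]
            exact Real.one_le_rpow_of_pos_of_le_one_of_nonpos hθ0 hθ1 (by linarith)
          calc F y * ∏ k, g k (y k) ≤ (θ ^ (-A) * θ ^ errs T c y) * (F y * ∏ k, g k (y k)) :=
                le_mul_of_one_le_left h0 h2
            _ = _ := by ring
        · exact mul_nonneg (by positivity)
            (mul_nonneg (hF y) (prod_nonneg fun k _ => htilt0 _ _))
    _ = θ ^ (-A) * ((∏ k ∈ S, ∑ b, tilt θ T c g k b) * G) := by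
        -- As `T ⊆ S`, tilting alters only coordinates that `F` ignores.
        rw [← mul_sum, hG (tilt θ T c g)]
        intro k hk
        ext b
        have : k ∉ T := fun h => hk (hTS h)
        simp [tilt, this]
    _ ≤ θ ^ (-A) * ((Real.exp (-(1 - θ) * ∑ k ∈ T, a k) * ∏ k ∈ S, ∑ b, g k b) * G) := by
        gcongr
    _ = (θ ^ (-A) * Real.exp (-(1 - θ) * ∑ k ∈ T, a k)) * ((∏ k ∈ S, ∑ b, g k b) * G) := by ring
    _ ≤ _ := by
        rw [hG g fun _ _ => rfl]
        refine mul_le_mul_of_nonneg_right (chernoff_lower_exponent hη hη1 hA0 hAn hA hθ) ?_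
        exact mul_nonneg (prod_nonneg fun k _ => hZ k) hG0

/-- The fraction of words with at most `r` nonzero entries in `T`. -/
theorem card_errs_le_le (T : Finset (Fin n)) (c : Fin n → ZMod 2) {l r : ℝ} (hl : 0 < l)
    (hl1 : l ≤ 1) :
    (#{v : Fin n → ZMod 2 | (errs T c v : ℝ) ≤ r} : ℝ)
      ≤ 2 ^ n * (l ^ (-r) * ((1 + l) / 2) ^ #T) := by
  calc (#{v : Fin n → ZMod 2 | (errs T c v : ℝ) ≤ r} : ℝ)
      = ∑ v : Fin n → ZMod 2, if (errs T c v : ℝ) ≤ r then (1 : ℝ) else 0 := by simp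
    _ ≤ ∑ v : Fin n → ZMod 2, l ^ (-r) * ∏ k, tilt l T c (fun _ _ => 1) k (v k) := by
        refine sum_le_sum fun v _ => ?_
        rw [prod_tilt, prod_const_one, mul_one]
        split_ifs with h
        · rw [← Real.rpow_natCast, ← Real.rpow_add hl]
          exact Real.one_le_rpow_of_pos_of_le_one_of_nonpos hl hl1 (by linarith)
        · positivity
    _ = _ := by
        rw [← mul_sum, sum_prod_eq]
        have : ∀ k, ∑ b, tilt l T c (fun _ _ => 1) k b
            = 2 * (if k ∈ T then (1 + l) / 2 else 1) := by
          intro k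
          rw [sum_tilt]
          simp only [sum_const, card_univ, ZMod.card]
          split_ifs
          · simp; ring
          · simp
        simp only [this, prod_mul_distrib, prod_const, card_univ, Fintype.card_fin]
        rw [prod_ite, prod_const_one, prod_const]
        simp
        ring

/-! ### A constant-weight family of noise patterns -/

theorem two_pow_le_mul_choose (n : ℕ) : 2 ^ n ≤ (n + 1) * n.choose (n / 2) := by
  rw [← Nat.sum_range_choose]
  refine (sum_le_card_nsmul _ _ (n.choose (n / 2)) fun r _ => Nat.choose_le_middle r n).trans ?_
  simp

/-- Markov's inequality for the generating function of the distance; symmetric difference with `b`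
is a bijection, so that function is `(1 + m)^n` for every centre. -/
theorem card_symmDiff_lt_le (b : Finset (Fin n)) {m r : ℝ} (hm : 0 < m) (hm1 : m ≤ 1) :
    (#{a : Finset (Fin n) | (#(symmDiff a b) : ℝ) < r} : ℝ) ≤ m ^ (-r) * (1 + m) ^ n := by
  calc (#{a : Finset (Fin n) | (#(symmDiff a b) : ℝ) < r} : ℝ)
      = ∑ a : Finset (Fin n), if (#(symmDiff a b) : ℝ) < r then (1 : ℝ) else 0 := by simp
    _ ≤ ∑ a : Finset (Fin n), m ^ (-r) * m ^ #(symmDiff a b) := by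
        refine sum_le_sum fun a _ => ?_
        split_ifs with h
        · rw [← Real.rpow_natCast, ← Real.rpow_add hm]
          exact Real.one_le_rpow_of_pos_of_le_one_of_nonpos hm hm1 (by linarith)
        · positivity
    _ = m ^ (-r) * ∑ a : Finset (Fin n), m ^ #a := by
        rw [← mul_sum]
        congr 1
        exact Equiv.sum_comp (symmDiff_left_involutive b).toPerm (fun a => m ^ #a)
    _ = _ := by
        rw [add_comm 1 m, ← Fin.sum_pow_mul_eq_add_pow]
        simp

/-- A constant-weight Gilbert–Varshamov code, as a family of sets with large pairwise differences. -/
theorem exists_patterns {M : ℕ} {c m : ℝ} (hm : 0 < m) (hm1 : m ≤ 1) (hc0 : 0 ≤ c)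
    (h : (M : ℝ) * ((n + 1) * (m ^ (-(2 * c * n)) * (1 + m) ^ n)) ≤ 2 ^ n) :
    ∃ B : Fin M → Finset (Fin n), ∀ i j, i ≠ j → c * n ≤ #(B i \ B j) := by
  classical
  let A := powersetCard (n / 2) (univ : Finset (Fin n))
  let P := A.powerset.filter fun S => ∀ a ∈ S, ∀ b ∈ S, a ≠ b → 2 * c * n ≤ #(symmDiff a b)
  obtain ⟨S, hSP, hmax⟩ := P.exists_max_image card ⟨∅, by simp [P]⟩
  obtain ⟨hSA, hS⟩ : S ⊆ A ∧ ∀ a ∈ S, ∀ b ∈ S, a ≠ b → 2 * c * n ≤ #(symmDiff a b) := by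
    simpa [P] using hSP
  -- A maximal separated family is covering: an uncovered set could be added to it.
  have hcover : ∀ a ∈ A, a ∉ S → ∃ b ∈ S, (#(symmDiff a b) : ℝ) < 2 * c * n := by
    intro a ha haS
    by_contra! hcon
    have : insert a S ∈ P := by
      simp only [P, mem_filter, mem_powerset]
      refine ⟨insert_subset ha hSA, ?_⟩
      intro x hx y hy hxy
      rw [mem_insert] at hx hy
      rcases hx with rfl | hx <;> rcases hy with rfl | hy
      · exact absurd rfl hxy
      · exact hcon _ hy
      · rw [symmDiff_comm]; exact hcon _ hx
      · exact hS _ hx _ hy hxy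
    have := hmax _ this
    rw [card_insert_of_notMem haS] at this
    omega
  let V : ℝ := m ^ (-(2 * c * n)) * (1 + m) ^ n
  have hV : 0 < V := by positivity
  have hcard : (#A : ℝ) ≤ #S * V := by
    -- At radius 0 the open balls do not contain their centres, so the covering argument changes:
    -- then `S` is all of `A`.
    by_cases hc : 0 < 2 * c * n
    · have hsub : A ⊆ S.biUnion fun b => {a | (#(symmDiff a b) : ℝ) < 2 * c * n} := by
        intro a ha
        simp only [mem_biUnion, mem_filter, mem_univ, true_and]
        by_cases haS : a ∈ S
        · exact ⟨a, haS, by simpa using hc⟩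
        · exact hcover a ha haS
      calc (#A : ℝ) ≤ ∑ b ∈ S, (#{a | (#(symmDiff a b) : ℝ) < 2 * c * n} : ℝ) := by
            exact_mod_cast (card_le_card hsub).trans card_biUnion_le
        _ ≤ ∑ b ∈ S, V := sum_le_sum fun b _ => card_symmDiff_lt_le b hm hm1
        _ = _ := by simp
    · have hsub : A ⊆ S := by
        intro a ha
        by_contra haS
        obtain ⟨b, _, hb⟩ := hcover a ha haS
        have : (0 : ℝ) ≤ #(symmDiff a b) := by positivity
        linarith
      calc (#A : ℝ) ≤ #S := by exact_mod_cast card_le_card hsub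
        _ ≤ #S * V := by
          refine le_mul_of_one_le_right (by positivity) ?_
          exact one_le_mul_of_one_le_of_one_le
            (Real.one_le_rpow_of_pos_of_le_one_of_nonpos hm hm1
              (neg_nonpos.2 (by positivity)))
            (one_le_pow₀ (by linarith))
  have hMS : M ≤ #S := by
    have h1 : (2 : ℝ) ^ n ≤ (n + 1) * #A := by
      simp only [A, card_powersetCard, card_univ, Fintype.card_fin]
      exact_mod_cast two_pow_le_mul_choose n
    have h2 : (M : ℝ) * ((n + 1) * V) ≤ #S * ((n + 1) * V) := by
      refine (h.trans h1).trans ?_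
      calc ((n : ℝ) + 1) * #A ≤ (n + 1) * (#S * V) := by gcongr
        _ = _ := by ring
    exact_mod_cast le_of_mul_le_mul_right h2 (by positivity)
  let e : Fin M → Finset (Fin n) := fun i => S.equivFin.symm (Fin.castLE hMS i)
  refine ⟨e, fun i j hij => ?_⟩
  have hne : e i ≠ e j := by
    intro he
    have := S.equivFin.symm.injective (Subtype.ext he)
    exact hij (Fin.castLE_injective hMS this)
  have hi : e i ∈ S := Subtype.property _
  have hj : e j ∈ S := Subtype.property _
  have h1 := hS _ hi _ hj hne
  -- Equal sizes split the symmetric difference evenly, so the one-sided difference `e i \ e j`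
  -- inherits half of the distance `2 c n`.
  have hci : #(e i) = #(e j) := by
    rw [(mem_powersetCard.1 (hSA hi)).2, (mem_powersetCard.1 (hSA hj)).2]
  have h2 : #(symmDiff (e i) (e j)) = #(e i \ e j) + #(e j \ e i) := by
    rw [symmDiff_def, sup_eq_union, card_union_of_disjoint]
    exact disjoint_sdiff_sdiff
  rw [h2, card_sdiff_comm hci.symm] at h1
  push_cast at h1
  rw [← card_sdiff_comm hci.symm]
  rw [← card_sdiff_comm hci.symm] at h1
  linarith

/-! ### Random coding over binary symmetric channels -/

/-- Transition probabilities of the binary symmetric channel with a real crossover parameter. -/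
def flip (a : ℝ) (x y : ZMod 2) : ℝ := if y = x then 1 - a else a

theorem flip_nonneg {a : ℝ} (h0 : 0 ≤ a) (h1 : a ≤ 1) (x y : ZMod 2) : 0 ≤ flip a x y := by
  unfold flip; split_ifs <;> linarith

theorem flip_self (a : ℝ) (x : ZMod 2) : flip a x x = 1 - a := by simp [flip]

theorem flip_add_one (a : ℝ) (x : ZMod 2) : flip a x (x + 1) = a := by simp [flip]

theorem sum_flip (a : ℝ) (x : ZMod 2) : ∑ y, flip a x y = 1 := by
  rw [sum_zmod_two x, flip_self, flip_add_one]; ring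

theorem errs_comm (T : Finset (Fin n)) (c y : Fin n → ZMod 2) : errs T c y = errs T y c := by
  simp only [errs, ne_comm]

/-- Averaging over coordinate `j` first: this treats codeword `j` as uniform while all the other
codewords are held fixed. -/
theorem sum_le_of_sum_coord_le {ι V : Type*} [Fintype ι] [DecidableEq ι] [Fintype V] (j : ι)
    (Φ : (ι → V) → ℝ) (f : ℝ)
    (h : ∀ u, ∑ v, Φ (Function.update u j v) ≤ Fintype.card V * f) :
    ∑ u, Φ u ≤ Fintype.card (ι → V) * f := by
  rcases isEmpty_or_nonempty V with hV | ⟨⟨v₀⟩⟩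
  · have : IsEmpty (ι → V) := ⟨fun u => hV.elim (u j)⟩
    simp
  rw [← (Equiv.funSplitAt j V).symm.sum_comp, Fintype.card_congr (Equiv.funSplitAt j V),
    Fintype.card_prod, Fintype.sum_prod_type_right]
  have : ∀ w : {k // k ≠ j} → V,
      ∑ v, Φ ((Equiv.funSplitAt j V).symm (v, w)) ≤ Fintype.card V * f := by
    intro w
    refine le_of_eq_of_le (sum_congr rfl fun v _ => congrArg Φ ?_)
      (h ((Equiv.funSplitAt j V).symm (v₀, w)))
    ext k
    by_cases hk : k = j
    · subst hk; simp [Equiv.funSplitAt, Equiv.piSplitAt]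
    · simp [Equiv.funSplitAt, Equiv.piSplitAt, hk]
  refine (sum_le_sum fun w _ => this w).trans ?_
  simp only [sum_const, card_univ, nsmul_eq_mul]
  push_cast
  exact le_of_eq (by ring)

/-- The probability that the word sent as `u i` is received within distance `r` of some other
codeword, summed over those codewords and over the sets `T t` of observed positions. -/
noncomputable def confusion {m : ℕ} {κ : Type} [Fintype κ] (T : κ → Finset (Fin n)) (b : Fin m → Fin n → ℝ)
    (r : ℝ) (u : Fin m → Fin n → ZMod 2) (i : Fin m) : ℝ :=
  ∑ t, ∑ j ∈ {i}ᶜ, ∑ y : Fin n → ZMod 2,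
    if (errs (T t) (u j) y : ℝ) ≤ r then ∏ k, flip (b i k) (u i k) (y k) else 0

/-- For `j ≠ i`, the word `u j` is uniform and independent of the output `y` produced by `u i`, so
it falls into the ball around `y` with probability at most `f`. A union bound over `j` and `t`
finishes. -/
theorem sum_confusion_le {m : ℕ} {κ : Type} [Fintype κ] (T : κ → Finset (Fin n))
    (b : Fin m → Fin n → ℝ) (hb0 : ∀ i k, 0 ≤ b i k) (hb1 : ∀ i k, b i k ≤ 1) {r l f : ℝ}
    (hl : 0 < l) (hl1 : l ≤ 1) (hf : ∀ t, l ^ (-r) * ((1 + l) / 2) ^ #(T t) ≤ f) (i : Fin m) :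
    ∑ u, confusion T b r u i
      ≤ Fintype.card (Fin m → Fin n → ZMod 2) * (Fintype.card κ * (m * f)) := by
  have key : ∀ t, ∀ j ∈ ({i}ᶜ : Finset (Fin m)), ∑ u : Fin m → Fin n → ZMod 2,
      ∑ y : Fin n → ZMod 2,
        (if (errs (T t) (u j) y : ℝ) ≤ r then ∏ k, flip (b i k) (u i k) (y k) else 0)
      ≤ Fintype.card (Fin m → Fin n → ZMod 2) * f := by
    intro t j hj
    have hji : i ≠ j := by simpa [eq_comm] using hj
    refine sum_le_of_sum_coord_le j _ f fun u => ?_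
    rw [sum_comm]
    simp only [Function.update_self, Function.update_of_ne hji]
    calc ∑ y : Fin n → ZMod 2, ∑ v : Fin n → ZMod 2,
          (if (errs (T t) v y : ℝ) ≤ r then ∏ k, flip (b i k) (u i k) (y k) else 0)
        = ∑ y : Fin n → ZMod 2, (#{v : Fin n → ZMod 2 | (errs (T t) y v : ℝ) ≤ r} : ℝ)
            * ∏ k, flip (b i k) (u i k) (y k) := by
          refine sum_congr rfl fun y _ => ?_
          rw [← sum_filter, sum_const, nsmul_eq_mul]
          simp only [errs_comm (T t) y]
      _ ≤ ∑ y : Fin n → ZMod 2, (2 ^ n * f) * ∏ k, flip (b i k) (u i k) (y k) := by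
          refine sum_le_sum fun y _ => mul_le_mul_of_nonneg_right ?_
            (prod_nonneg fun k _ => flip_nonneg (hb0 i k) (hb1 i k) _ _)
          exact (card_errs_le_le (T t) y hl hl1).trans (by gcongr; exact hf t)
      _ = _ := by
          rw [← mul_sum, sum_prod_eq (fun k => flip (b i k) (u i k))]
          simp [sum_flip]
  -- The sign of `f` is known only through some `t`; for empty `κ` it is not needed.
  have hf0 : ∀ t : κ, 0 ≤ f := fun t => le_trans (by positivity) (hf t)
  unfold confusion
  rw [sum_comm]
  calc _ ≤ ∑ t : κ, (Fintype.card (Fin m → Fin n → ZMod 2) * (m * f) : ℝ) := by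
        refine sum_le_sum fun t _ => ?_
        rw [sum_comm]
        refine (sum_le_sum (key t)).trans ?_
        rw [sum_const, nsmul_eq_mul]
        have : (#({i}ᶜ : Finset (Fin m)) : ℝ) ≤ m := by
          exact_mod_cast card_finset_fin_le _
        calc (#({i}ᶜ : Finset (Fin m)) : ℝ) * (Fintype.card (Fin m → Fin n → ZMod 2) * f)
            ≤ m * (Fintype.card (Fin m → Fin n → ZMod 2) * f) :=
              mul_le_mul_of_nonneg_right this (mul_nonneg (by positivity) (hf0 t))
          _ = _ := by ring
    _ = _ := by
        rw [sum_const, nsmul_eq_mul, card_univ]; ring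

/-- Random coding followed by expurgation. -/
theorem exists_codebook {M : ℕ} {κ : Type} [Fintype κ] (T : κ → Finset (Fin n))
    (b : Fin (2 * M) → Fin n → ℝ) (hb0 : ∀ i k, 0 ≤ b i k) (hb1 : ∀ i k, b i k ≤ 1) {r l f ε : ℝ}
    (hl : 0 < l) (hl1 : l ≤ 1) (hf : ∀ t, l ^ (-r) * ((1 + l) / 2) ^ #(T t) ≤ f)
    (hε : 0 < ε) (hfε : Fintype.card κ * ((2 * M : ℕ) * f) ≤ ε) :
    ∃ (u : Fin (2 * M) → Fin n → ZMod 2) (e : Fin M → Fin (2 * M)), Function.Injective e ∧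
      ∀ i, confusion T b r u (e i) ≤ 2 * ε := by
  classical
  obtain ⟨u, -, hu⟩ : ∃ u ∈ (univ : Finset (Fin (2 * M) → Fin n → ZMod 2)),
      ∑ i, confusion T b r u i ≤ (2 * M : ℕ) * ε := by
    refine exists_le_of_sum_le univ_nonempty ?_
    rw [sum_comm]
    refine (sum_le_sum fun i _ => sum_confusion_le T b hb0 hb1 hl hl1 hf i).trans ?_
    simp only [sum_const, card_univ, nsmul_eq_mul, Fintype.card_fin]
    calc ((2 * M : ℕ) : ℝ) * (Fintype.card (Fin (2 * M) → Fin n → ZMod 2)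
          * (Fintype.card κ * ((2 * M : ℕ) * f)))
        ≤ (2 * M : ℕ) * (Fintype.card (Fin (2 * M) → Fin n → ZMod 2) * ε) := by gcongr
      _ = _ := by ring
  let S : Finset (Fin (2 * M)) := {i | confusion T b r u i ≤ 2 * ε}
  have h0 : ∀ i, 0 ≤ confusion T b r u i := fun i =>
    sum_nonneg fun t _ => sum_nonneg fun j _ => sum_nonneg fun y _ => by
      split_ifs
      · exact prod_nonneg fun k _ => flip_nonneg (hb0 i k) (hb1 i k) _ _
      · exact le_rfl
  -- Markov: at most half of the `2 * M` indices exceed twice the average, which leaves `M` good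
  -- ones.
  have hbad : (#Sᶜ : ℝ) * (2 * ε) ≤ (2 * M : ℕ) * ε := by
    calc (#Sᶜ : ℝ) * (2 * ε) = ∑ i ∈ Sᶜ, 2 * ε := by simp
      _ ≤ ∑ i ∈ Sᶜ, confusion T b r u i := by
          refine sum_le_sum fun i hi => ?_
          simp only [S, mem_compl, mem_filter, mem_univ, true_and, not_le] at hi
          exact hi.le
      _ ≤ ∑ i, confusion T b r u i :=
          sum_le_sum_of_subset_of_nonneg (subset_univ _) fun i _ _ => h0 i
      _ ≤ _ := hu
  have hbad' : #Sᶜ ≤ M := by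
    have : (#Sᶜ : ℝ) ≤ M := by
      push_cast at hbad
      have h2 : (#Sᶜ : ℝ) * (2 * ε) ≤ M * (2 * ε) := by linarith
      exact le_of_mul_le_mul_right h2 (by positivity)
    exact_mod_cast this
  have hS : M ≤ #S := by
    have := card_add_card_compl S
    rw [Fintype.card_fin] at this
    omega
  refine ⟨u, fun i => S.equivFin.symm (Fin.castLE hS i), ?_, fun i => ?_⟩
  · intro i j hij
    exact Fin.castLE_injective hS (S.equivFin.symm.injective (Subtype.ext hij))
  · have : (S.equivFin.symm (Fin.castLE hS i) : Fin (2 * M)) ∈ S := Subtype.property _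
    exact (mem_filter.1 this).2

theorem CondDist.prob_le_one {A B : Type} [Fintype B] (P : CondDist A B) (a : A) (b : B) :
    P.prob a b ≤ 1 := by
  rw [← P.sum_one a]
  exact single_le_sum (fun b _ => P.nonneg a b) (mem_univ b)

/-! ### Reducing the error to a legitimate and an undetected part -/

section Decomposition

variable {X S Y Z : Type} [Fintype X] [Fintype Y] [Fintype Z] {M : ℕ}

theorem decProb_nonneg (ch : MyopicChannel X S Y Z) (c : AuthCode X Y M n)
    (D : Finset (Option (Fin M))) (x : Fin n → X) (s : Fin n → S) : 0 ≤ decProb ch c D x s :=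
  sum_nonneg fun y _ => (ch.W.block n).nonneg _ y

theorem decProb_add_compl (ch : MyopicChannel X S Y Z) (c : AuthCode X Y M n)
    (D : Finset (Option (Fin M))) (x : Fin n → X) (s : Fin n → S) :
    decProb ch c D x s + decProb ch c Dᶜ x s = 1 := by
  unfold decProb
  rw [← (ch.W.block n).sum_one (fun k => (x k, s k)),
    ← sum_filter_add_sum_filter_not univ (fun y => c.dec y ∈ D)]
  simp only [mem_compl]

/-- It suffices to bound the error without adversary, and the probability of an undetected error
given the adversary's observation and the state sequence. -/
theorem errorProb_le [Fintype S] [DecidableEq S] (ch : MyopicChannel X S Y Z) (c : AuthCode X Y M n)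
    (J : CondDist (Fin n → Z) (Fin n → S)) (i : Fin M) {ε₀ ε : ℝ} (hε : 0 ≤ ε)
    (h0 : ∑ x, c.enc.prob i x * decProb ch c {some i}ᶜ x (fun _ => ch.s₀) ≤ ε₀)
    (h1 : ∀ z s, ∑ x, c.enc.prob i x * ((ch.U.block n).prob x z * decProb ch c {some i, none}ᶜ x s)
      ≤ ε * ∑ x, c.enc.prob i x * (ch.U.block n).prob x z) :
    errorProb ch c J i ≤ ε₀ + ε := by
  unfold errorProb
  simp only [mul_add, sum_add_distrib]
  refine add_le_add (le_trans (sum_le_sum fun x _ => ?_) h0) ?_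
  · refine mul_le_mul_of_nonneg_left ?_ (c.enc.nonneg i x)
    rw [← sum_mul]
    refine mul_le_of_le_one_left (decProb_nonneg _ _ _ _ _) ?_
    rw [← (ch.U.block n).sum_one x]
    exact sum_le_sum fun z _ =>
      mul_le_of_le_one_right ((ch.U.block n).nonneg x z) (J.prob_le_one _ _)
  · calc ∑ x, c.enc.prob i x * ∑ s ∈ {fun _ => ch.s₀}ᶜ, ∑ z, (ch.U.block n).prob x z * J.prob z s
            * decProb ch c {some i, none}ᶜ x s
        = ∑ s ∈ ({fun _ => ch.s₀}ᶜ : Finset (Fin n → S)), ∑ z, J.prob z s * ∑ x, c.enc.prob i x *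
            ((ch.U.block n).prob x z * decProb ch c {some i, none}ᶜ x s) := by
          simp only [mul_sum]
          rw [sum_comm]
          refine sum_congr rfl fun s _ => ?_
          rw [sum_comm]
          exact sum_congr rfl fun z _ => sum_congr rfl fun x _ => by ring
      _ ≤ ∑ s ∈ ({fun _ => ch.s₀}ᶜ : Finset (Fin n → S)), ∑ z, J.prob z s *
            (ε * ∑ x, c.enc.prob i x * (ch.U.block n).prob x z) :=
          sum_le_sum fun s _ => sum_le_sum fun z _ =>
            mul_le_mul_of_nonneg_left (h1 z s) (J.nonneg z s)
      -- Completing the sum to all states lets `J` sum to 1 for each `z`; a bound uniform in `(z,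
      -- s)` thus covers every adversary.
      _ ≤ ∑ s, ∑ z, J.prob z s * (ε * ∑ x, c.enc.prob i x * (ch.U.block n).prob x z) :=
          sum_le_sum_of_subset_of_nonneg (subset_univ _) fun s _ _ => sum_nonneg fun z _ =>
            mul_nonneg (J.nonneg z s) (mul_nonneg hε (sum_nonneg fun x _ =>
              mul_nonneg (c.enc.nonneg i x) ((ch.U.block n).nonneg x z)))
      _ = ε := by
          rw [sum_comm]
          simp only [← sum_mul, J.sum_one, one_mul, ← mul_sum]
          rw [sum_comm]
          simp only [← mul_sum, (ch.U.block n).sum_one, mul_one, c.enc.sum_one]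

end Decomposition

/-! ### The code with artificial noise and its decoder -/

/-- The data of a code: codewords, noisy positions, parts of the block, thresholds. -/
structure CodeData (n M : ℕ) (κ : Type) where
  word : Fin M → Fin n → ZMod 2
  noisy : Fin M → Finset (Fin n)
  part : κ → Finset (Fin n)
  delta : ℝ
  delta_nonneg : 0 ≤ delta
  delta_le : delta ≤ 1 / 2
  crossover : ℝ
  radius : ℝ
  slack : ℝ

namespace CodeData

variable {M : ℕ} {κ : Type} (C : CodeData n M κ)

/-- The level of the artificial noise which the encoder adds at position `k` for message `i`. -/
def noise (i : Fin M) (k : Fin n) : ℝ := if k ∈ C.noisy i then C.delta else 0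

theorem noise_nonneg (i : Fin M) (k : Fin n) : 0 ≤ C.noise i k := by
  unfold noise; split_ifs; exacts [C.delta_nonneg, le_rfl]

theorem noise_le_delta (i : Fin M) (k : Fin n) : C.noise i k ≤ C.delta := by
  unfold noise; split_ifs; exacts [le_rfl, C.delta_nonneg]

theorem noise_le_one (i : Fin M) (k : Fin n) : C.noise i k ≤ 1 := by
  linarith [C.noise_le_delta i k, C.delta_le]

/-- Outside of the part `t`, the word `y` is close to codeword `j`. -/
def Close (t : κ) (j : Fin M) (y : Fin n → ZMod 2) : Prop :=
  (errs (C.part t)ᶜ (C.word j) y : ℝ) ≤ C.radius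

/-- Within the part `t`, at the noiseless positions of message `j`, the errors are not too many. -/
def Test (t : κ) (j : Fin M) (y : Fin n → ZMod 2) : Prop :=
  (errs (C.part t \ C.noisy j) (C.word j) y : ℝ)
    ≤ C.crossover * #(C.part t \ C.noisy j) + C.slack * n

/-- For fixed `t` and `y` this holds for at most one `j`, and it depends on `y` only outside part
`t`. Both facts are what `undetected_le` rests on. -/
def UniqueClose (t : κ) (j : Fin M) (y : Fin n → ZMod 2) : Prop :=
  C.Close t j y ∧ ∀ j', j' ≠ j → ¬ C.Close t j' y

def Accept (j : Fin M) (y : Fin n → ZMod 2) : Prop :=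
  ∀ t, C.UniqueClose t j y ∧ C.Test t j y

open Classical in
/-- The authentication code: codewords with artificial noise at message-dependent positions, and
acceptance tests at the receiver. -/
noncomputable def code : AuthCode (ZMod 2) (ZMod 2) M n where
  enc :=
    { prob := fun i x => ∏ k, flip (C.noise i k) (C.word i k) (x k)
      nonneg := fun i x => prod_nonneg fun k _ =>
        flip_nonneg (C.noise_nonneg i k) (C.noise_le_one i k) _ _
      sum_one := fun i => by
        rw [sum_prod_eq (fun k => flip (C.noise i k) (C.word i k))]
        simp [sum_flip] }
  dec y := if h : ∃ j, C.Accept j y then some h.choose else none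

theorem accept_of_dec_eq_some {y : Fin n → ZMod 2} {j : Fin M} (h : C.code.dec y = some j) :
    C.Accept j y := by
  simp only [code] at h
  split_ifs at h with hj
  rw [← Option.some_injective _ h]
  exact hj.choose_spec

/-- Uniqueness for a single part already rules out a second accepted message, so the choice in the
decoder is forced; with no parts every message would be accepted. -/
theorem dec_eq_some_of_accept [Nonempty κ] {y : Fin n → ZMod 2} {j : Fin M} (h : C.Accept j y) :
    C.code.dec y = some j := by
  have hj : ∃ j, C.Accept j y := ⟨j, h⟩
  have hd : C.code.dec y = some hj.choose := by simp only [code, dif_pos hj]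
  rw [hd]
  by_contra hne
  obtain ⟨t⟩ := ‹Nonempty κ›
  have hne' : j ≠ hj.choose := fun h' => hne (by rw [← h'])
  exact (hj.choose_spec t).1.2 j hne' (h t).1.1

/-- The crossover probability of the artificial noise followed by a BSC(`p`). -/
def received (p : ℝ) (i : Fin M) (k : Fin n) : ℝ :=
  C.noise i k * (1 - p) + (1 - C.noise i k) * p

theorem sum_flip_mul_flip (a p : ℝ) (c y : ZMod 2) :
    ∑ x, flip a c x * flip p x y = flip (a * (1 - p) + (1 - a) * p) c y := by
  have h1 : c + 1 + 1 = c := by revert c; decide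
  rw [sum_zmod_two c, flip_self, flip_add_one]
  rcases ZMod.two_eq_or c y with rfl | rfl
  · have : flip p (y + 1) y = p := by
      have := flip_add_one p (y + 1); rwa [h1] at this
    rw [flip_self, this, flip_self]; ring
  · rw [flip_self, flip_add_one, flip_add_one]; ring

theorem sum_enc_mul_decProb (p q : unitInterval) (i : Fin M) (D : Finset (Option (Fin M))) :
    ∑ x, C.code.enc.prob i x * decProb (mbac p q) C.code D x (fun _ => (mbac p q).s₀)
      = ∑ y with C.code.dec y ∈ D, ∏ k, flip (C.received p i k) (C.word i k) (y k) := by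
  unfold decProb
  simp only [mul_sum]
  rw [sum_comm]
  refine sum_congr rfl fun y _ => ?_
  have : ∀ x : Fin n → ZMod 2, C.code.enc.prob i x * ((mbac p q).W.block n).prob
      (fun k => (x k, (mbac p q).s₀)) y
      = ∏ k, flip (C.noise i k) (C.word i k) (x k) * flip p (x k) (y k) := by
    intro x
    rw [prod_mul_distrib]
    simp [code, CondDist.block, mbac, bsc, flip]
  simp only [this]
  rw [sum_prod_eq (fun k b => flip (C.noise i k) (C.word i k) b * flip p b (y k))]
  simp only [sum_flip_mul_flip, received]

/-! ### Undetected errors under attack -/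

/-- The joint weight of the adversary's observation `z` and the received letter `b` at a position. -/
def attackWeight (p q : ℝ) (i : Fin M) (z s : Fin n → ZMod 2) (k : Fin n) (b : ZMod 2) : ℝ :=
  ∑ x, flip (C.noise i k) (C.word i k) x * (flip q x (z k) * flip p (x + s k) b)

theorem sum_attackWeight (p q : ℝ) (i : Fin M) (z s : Fin n → ZMod 2) (k : Fin n) :
    ∑ b, C.attackWeight p q i z s k b
      = ∑ x, flip (C.noise i k) (C.word i k) x * flip q x (z k) := by
  unfold attackWeight
  rw [sum_comm]
  simp only [← mul_sum, sum_flip, mul_one]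

theorem sum_enc_mul_U (p q : unitInterval) (i : Fin M) (z s : Fin n → ZMod 2) :
    ∑ x, C.code.enc.prob i x * ((mbac p q).U.block n).prob x z
      = ∏ k, ∑ b, C.attackWeight p q i z s k b := by
  simp only [sum_attackWeight]
  rw [← sum_prod_eq (fun k x => flip (C.noise i k) (C.word i k) x * flip q x (z k))]
  refine sum_congr rfl fun x _ => ?_
  rw [prod_mul_distrib]
  simp [code, CondDist.block, mbac, bsc, flip]

theorem sum_enc_mul_U_mul_decProb (p q : unitInterval) (i : Fin M) (D : Finset (Option (Fin M)))
    (z s : Fin n → ZMod 2) :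
    ∑ x, C.code.enc.prob i x * (((mbac p q).U.block n).prob x z * decProb (mbac p q) C.code D x s)
      = ∑ y with C.code.dec y ∈ D, ∏ k, C.attackWeight p q i z s k (y k) := by
  unfold decProb
  simp only [mul_sum]
  rw [sum_comm]
  refine sum_congr rfl fun y _ => ?_
  have : ∀ x : Fin n → ZMod 2, C.code.enc.prob i x * (((mbac p q).U.block n).prob x z *
      ((mbac p q).W.block n).prob (fun k => (x k, s k)) y)
      = ∏ k, flip (C.noise i k) (C.word i k) (x k) * (flip q (x k) (z k) *
        flip p (x k + s k) (y k)) := by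
    intro x
    rw [prod_mul_distrib, prod_mul_distrib]
    simp [code, CondDist.block, mbac, bsc, flip]
  simp only [this]
  rw [sum_prod_eq (fun k b => flip (C.noise i k) (C.word i k) b * (flip q b (z k) *
        flip p (b + s k) (y k)))]
  simp only [attackWeight]

theorem attackWeight_nonneg {p q : ℝ} (hp0 : 0 ≤ p) (hp1 : p ≤ 1) (hq0 : 0 ≤ q) (hq1 : q ≤ 1)
    (i : Fin M) (z s : Fin n → ZMod 2) (k : Fin n) (b : ZMod 2) :
    0 ≤ C.attackWeight p q i z s k b :=
  sum_nonneg fun _ _ => mul_nonneg (flip_nonneg (C.noise_nonneg i k) (C.noise_le_one i k) _ _)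
    (mul_nonneg (flip_nonneg hq0 hq1 _ _) (flip_nonneg hp0 hp1 _ _))

/-- Whatever the adversary does, at each position the conditional probability of an error is at
least `p`, and it is larger by a constant at the noisy positions. -/
theorem le_attackWeight {p q : ℝ} (hp1 : p ≤ 1 / 2) (hq0 : 0 ≤ q) (hq1 : q ≤ 1 / 2)
    (i : Fin M) (z s : Fin n → ZMod 2) (k : Fin n) (c : ZMod 2) :
    (p + if k ∈ C.noisy i then (1 - 2 * p) * (C.delta * q) else 0)
        * ∑ b, C.attackWeight p q i z s k b
      ≤ C.attackWeight p q i z s k (c + 1) := by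
  rw [sum_attackWeight]
  unfold attackWeight
  obtain ⟨w, hw⟩ : ∃ w : ZMod 2 → ℝ, ∀ x, w x = flip (C.noise i k) (C.word i k) x * flip q x (z k) :=
    ⟨_, fun _ => rfl⟩
  have hw0 : ∀ x, 0 ≤ w x := fun x => by
    rw [hw]
    exact mul_nonneg (flip_nonneg (C.noise_nonneg i k) (C.noise_le_one i k) _ _)
      (flip_nonneg hq0 (by linarith) _ _)
  have hw1 : ∑ x, w x ≤ 1 := by
    rw [← sum_flip (C.noise i k) (C.word i k)]
    refine sum_le_sum fun x _ => ?_
    rw [hw]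
    refine mul_le_of_le_one_right (flip_nonneg (C.noise_nonneg i k) (C.noise_le_one i k) _ _) ?_
    unfold flip; split_ifs <;> linarith
  simp only [← mul_assoc, ← hw]
  have h1 : c + s k + 1 + s k = c + 1 := by generalize s k = a; clear * -; revert c a; decide
  have h2 : c + s k + s k = c := by generalize s k = a; clear * -; revert c a; decide
  have hδ := C.delta_nonneg
  have hδ1 := C.delta_le
  rw [sum_zmod_two (c + s k)] at hw1
  rw [sum_zmod_two (c + s k), sum_zmod_two (c + s k), h1, h2, flip_self, flip_add_one]
  split_ifs with hk
  -- The error weight is `p` times the total plus `(1 - 2p)` times the weight of the input `c + s k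
  -- + 1`. As `δ` and `q` are at most `1/2`, at a noisy position neither input has joint weight
  -- below `δ q`.
  · have hbound : C.delta * q ≤ w (c + s k + 1) := by
      rw [hw, noise, if_pos hk]
      refine mul_le_mul ?_ ?_ hq0 ?_
      · unfold flip; split_ifs <;> linarith
      · unfold flip; split_ifs <;> linarith
      · exact flip_nonneg hδ (by linarith) _ _
    have h3 : (1 - 2 * p) * (C.delta * q) * (w (c + s k) + w (c + s k + 1))
        ≤ (1 - 2 * p) * w (c + s k + 1) := by
      have h12 : 0 ≤ 1 - 2 * p := by linarith
      calc (1 - 2 * p) * (C.delta * q) * (w (c + s k) + w (c + s k + 1))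
          ≤ (1 - 2 * p) * (C.delta * q) * 1 := by gcongr
        _ ≤ _ := by rw [mul_one]; gcongr
    linarith
  · nlinarith [hw0 (c + s k), hw0 (c + s k + 1)]

open Classical in
/-- Undetected errors are unlikely given the adversary's observation and the state. -/
theorem undetected_le [Fintype κ] (p q : unitInterval) (hp : (p : ℝ) ≤ 1 / 2)
    (hq : (q : ℝ) ≤ 1 / 2)
    (hC : C.crossover = p) (hs : 0 < C.slack) (hs1 : C.slack ≤ 1 / 2) (i : Fin M)
    (hsep : ∀ j, i ≠ j → ∃ t, 2 * C.slack * n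
      ≤ (1 - 2 * (p : ℝ)) * (C.delta * q) * #(C.part t ∩ (C.noisy i \ C.noisy j)))
    (z s : Fin n → ZMod 2) :
    ∑ y with C.code.dec y ∈ ({some i, none}ᶜ : Finset (Option (Fin M))),
        ∏ k, C.attackWeight p q i z s k (y k)
      ≤ Fintype.card κ * Real.exp (-(C.slack ^ 2 / 6) * n)
        * ∏ k, ∑ b, C.attackWeight p q i z s k b := by
  have hp0 := p.2.1
  have hq0 := q.2.1
  obtain ⟨g, hg⟩ : ∃ g, g = C.attackWeight p q i z s := ⟨_, rfl⟩
  have hg0 : ∀ k b, 0 ≤ g k b := fun k b => by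
    rw [hg]; exact C.attackWeight_nonneg hp0 p.2.2 hq0 q.2.2 i z s k b
  have hgc : ∀ k c, ((p : ℝ) + if k ∈ C.noisy i then (1 - 2 * (p : ℝ)) * (C.delta * q) else 0)
      * ∑ b, g k b ≤ g k (c + 1) := fun k c => by
    rw [hg]; exact C.le_attackWeight hp hq0 hq i z s k c
  rw [← hg]
  have hw0 : ∀ y : Fin n → ZMod 2, 0 ≤ ∏ k, g k (y k) := fun y => prod_nonneg fun k _ => hg0 _ _
  have key : ∀ j ∈ ({i}ᶜ : Finset (Fin M)), ∑ y : Fin n → ZMod 2,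
      (if C.Accept j y then ∏ k, g k (y k) else 0)
      ≤ Real.exp (-(C.slack ^ 2 / 6) * n) * ∑ t, ∑ y : Fin n → ZMod 2,
          (if C.UniqueClose t j y then 1 else 0) * ∏ k, g k (y k) := by
    intro j hj
    obtain ⟨t, ht⟩ := hsep j (by simpa [eq_comm] using hj)
    have hT : (#(C.part t \ C.noisy j) : ℝ) ≤ n := by exact_mod_cast card_finset_fin_le _
    have hγ : (1 - 2 * (p : ℝ)) * (C.delta * q) ≤ 1 / 2 := by
      have h1 : C.delta * q ≤ 1 / 2 := by nlinarith [C.delta_nonneg, C.delta_le]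
      have h2 : 0 ≤ C.delta * q := mul_nonneg C.delta_nonneg hq0
      nlinarith
    -- Inside part `t`, the surplus from `B i \ B j` is at least `2 * slack * n`: one half covers
    -- the slack in the test threshold, the other is the Chernoff deviation.
    have := sum_mul_errs_le_le (C.part t) (C.part t \ C.noisy j) sdiff_subset (C.word j) g hg0
      (fun y => if C.UniqueClose t j y then 1 else 0)
      (fun y => by positivity)
      (by
        intro y y' hyy'
        have hclose : ∀ j, C.Close t j y ↔ C.Close t j y' := by
          intro j
          have : errs (C.part t)ᶜ (C.word j) y = errs (C.part t)ᶜ (C.word j) y' := by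
            unfold errs
            congr 1
            refine filter_congr fun k hk => ?_
            rw [hyy' k (mem_compl.1 hk)]
          rw [Close, Close, this]
        exact if_congr (by simp only [UniqueClose, hclose]) rfl rfl)
      (fun k => (p : ℝ) + if k ∈ C.noisy i then (1 - 2 * (p : ℝ)) * (C.delta * q) else 0)
      (fun k => by split_ifs <;> linarith)
      (fun k => hgc k (C.word j k)) hs (by linarith)
      (A := C.crossover * #(C.part t \ C.noisy j) + C.slack * n)
      (by rw [hC]; positivity)
      (by
        rw [hC]
        have : (p : ℝ) * #(C.part t \ C.noisy j) ≤ 1 / 2 * n := by gcongr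
        have : C.slack * n ≤ 1 / 2 * n := by gcongr
        linarith)
      (by
        rw [sum_add_distrib, sum_const, nsmul_eq_mul, ← sum_filter, sum_const, nsmul_eq_mul, hC]
        have : filter (fun k => k ∈ C.noisy i) (C.part t \ C.noisy j)
            = C.part t ∩ (C.noisy i \ C.noisy j) := by
          ext k; simp; tauto
        rw [this]
        linarith)
    calc ∑ y : Fin n → ZMod 2, (if C.Accept j y then ∏ k, g k (y k) else 0)
        ≤ ∑ y : Fin n → ZMod 2, (if (errs (C.part t \ C.noisy j) (C.word j) y : ℝ)
            ≤ C.crossover * #(C.part t \ C.noisy j) + C.slack * n then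
            (if C.UniqueClose t j y then 1 else 0) * ∏ k, g k (y k) else 0) := by
          refine sum_le_sum fun y _ => ?_
          by_cases ha : C.Accept j y
          · have h1 := (ha t).1
            have h2 := (ha t).2
            unfold Test at h2
            simp [ha, h1, h2]
          · rw [if_neg ha]
            split_ifs <;> simp [hw0 y]
      _ ≤ _ := this
      _ ≤ _ := by
          refine mul_le_mul_of_nonneg_left ?_ (Real.exp_pos _).le
          -- The separating part depends on `j`; summing over all parts makes the bound uniform, so
          -- that `j` can be summed next.
          exact single_le_sum (f := fun t => ∑ y : Fin n → ZMod 2,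
            (if C.UniqueClose t j y then (1 : ℝ) else 0) * ∏ k, g k (y k))
            (fun t _ => sum_nonneg fun y _ => mul_nonneg (by positivity) (hw0 y)) (mem_univ t)
  calc ∑ y with C.code.dec y ∈ ({some i, none}ᶜ : Finset (Option (Fin M))), ∏ k, g k (y k)
      ≤ ∑ y : Fin n → ZMod 2, ∑ j ∈ ({i}ᶜ : Finset (Fin M)),
          (if C.Accept j y then ∏ k, g k (y k) else 0) := by
        rw [sum_filter]
        refine sum_le_sum fun y _ => ?_
        have hnn : ∀ j ∈ ({i}ᶜ : Finset (Fin M)),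
            0 ≤ if C.Accept j y then ∏ k, g k (y k) else 0 := fun j _ => by
          split_ifs; exacts [hw0 y, le_rfl]
        split_ifs with h
        · obtain ⟨j, hj⟩ : ∃ j, C.code.dec y = some j := by
            rcases hd : C.code.dec y with _ | j
            · simp [hd] at h
            · exact ⟨j, rfl⟩
          have hji : j ∈ ({i}ᶜ : Finset (Fin M)) := by
            rw [hj] at h
            simpa using h
          refine le_trans (le_of_eq ?_) (single_le_sum hnn hji)
          rw [if_pos (C.accept_of_dec_eq_some hj)]
        · exact sum_nonneg hnn
    _ = ∑ j ∈ ({i}ᶜ : Finset (Fin M)), ∑ y : Fin n → ZMod 2,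
          (if C.Accept j y then ∏ k, g k (y k) else 0) := sum_comm
    _ ≤ ∑ j ∈ ({i}ᶜ : Finset (Fin M)), Real.exp (-(C.slack ^ 2 / 6) * n) *
          ∑ t, ∑ y : Fin n → ZMod 2, (if C.UniqueClose t j y then 1 else 0) * ∏ k, g k (y k) :=
        sum_le_sum key
    _ = Real.exp (-(C.slack ^ 2 / 6) * n) * ∑ t, ∑ y : Fin n → ZMod 2,
          (∑ j ∈ ({i}ᶜ : Finset (Fin M)), if C.UniqueClose t j y then 1 else 0)
            * ∏ k, g k (y k) := by
        rw [← mul_sum, sum_comm]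
        congr 1
        refine sum_congr rfl fun t _ => ?_
        rw [sum_comm]
        simp only [sum_mul]
    _ ≤ Real.exp (-(C.slack ^ 2 / 6) * n) * ∑ t : κ, ∑ y : Fin n → ZMod 2, 1 * ∏ k, g k (y k) := by
        refine mul_le_mul_of_nonneg_left ?_ (Real.exp_pos _).le
        refine sum_le_sum fun t _ => sum_le_sum fun y _ => mul_le_mul_of_nonneg_right ?_ (hw0 y)
        rw [← sum_filter, sum_const, nsmul_eq_mul, mul_one]
        -- This replaces the union bound over exponentially many messages: each output has at most
        -- one candidate per part.
        have : #(filter (fun j => C.UniqueClose t j y) ({i}ᶜ : Finset (Fin M))) ≤ 1 := by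
          rw [card_le_one]
          intro a ha b hb
          by_contra hab
          exact (mem_filter.1 hb).2.2 a hab (mem_filter.1 ha).2.1
        exact_mod_cast this
    _ = _ := by
        simp only [one_mul]
        rw [sum_prod_eq, sum_const, nsmul_eq_mul, card_univ]
        ring

/-! ### Errors in the absence of the adversary -/

theorem received_nonneg {p : ℝ} (hp0 : 0 ≤ p) (hp1 : p ≤ 1) (i : Fin M) (k : Fin n) :
    0 ≤ C.received p i k :=
  add_nonneg (mul_nonneg (C.noise_nonneg i k) (sub_nonneg.2 hp1))
    (mul_nonneg (sub_nonneg.2 (C.noise_le_one i k)) hp0)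

theorem received_le {p : ℝ} (hp0 : 0 ≤ p) (i : Fin M) (k : Fin n) :
    C.received p i k ≤ p + C.noise i k := by
  unfold received
  nlinarith [mul_nonneg (C.noise_nonneg i k) hp0]

theorem received_le_one {p : ℝ} (hp0 : 0 ≤ p) (hp : p ≤ 1 / 2) (i : Fin M) (k : Fin n) :
    C.received p i k ≤ 1 := by
  linarith [C.received_le hp0 i k, C.noise_le_delta i k, C.delta_le]

open Classical in
/-- The error probability in the absence of the adversary. -/
theorem legitimate_error_le [Fintype κ] [Nonempty κ] {p : ℝ} (hp0 : 0 ≤ p) (hp : p ≤ 1 / 2)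
    (hC : C.crossover = p) (hs : 0 < C.slack) (hs1 : C.slack ≤ 1)
    (hr : C.radius = (p + C.delta) * n + C.slack * n) (i : Fin M) :
    ∑ y with C.code.dec y ∈ ({some i}ᶜ : Finset (Option (Fin M))),
        ∏ k, flip (C.received p i k) (C.word i k) (y k)
      ≤ Fintype.card κ * (2 * Real.exp (-(C.slack ^ 2 / 6) * n))
        + confusion (fun t => (C.part t)ᶜ) (C.received p) C.radius C.word i := by
  obtain ⟨g, hg⟩ : ∃ g : Fin n → ZMod 2 → ℝ, g = fun k => flip (C.received p i k) (C.word i k) :=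
    ⟨_, rfl⟩
  have hg0 : ∀ k b, 0 ≤ g k b := fun k b => by
    rw [hg]
    exact flip_nonneg (C.received_nonneg hp0 (by linarith) i k) (C.received_le_one hp0 hp i k) _ _
  have hg1 : ∀ k, ∑ b, g k b = 1 := fun k => by rw [hg]; exact sum_flip _ _
  have hgc : ∀ k, g k (C.word i k + 1) = C.received p i k := fun k => by
    rw [hg]; exact flip_add_one _ _
  have hcl : ∀ t, ∑ y : Fin n → ZMod 2, (if C.Close t i y then 0 else ∏ k, g k (y k))
      ≤ Real.exp (-(C.slack ^ 2 / 6) * n) := by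
    intro t
    have := sum_errs_gt_le (C.part t)ᶜ (C.word i) g hg0 hg1 hs hs1
      (A := (p + C.delta) * n)
      (by
        simp only [hgc]
        calc ∑ k ∈ (C.part t)ᶜ, C.received p i k ≤ ∑ _k ∈ (C.part t)ᶜ, (p + C.delta) :=
              sum_le_sum fun k _ => (C.received_le hp0 i k).trans (by
                linarith [C.noise_le_delta i k])
          _ = #(C.part t)ᶜ * (p + C.delta) := by rw [sum_const, nsmul_eq_mul]
          _ ≤ n * (p + C.delta) := by
              have : (#(C.part t)ᶜ : ℝ) ≤ n := by exact_mod_cast card_finset_fin_le _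
              have := C.delta_nonneg
              gcongr
          _ = _ := by ring)
      (by
        have := C.delta_le
        exact mul_le_of_le_one_left (by positivity) (by linarith))
    refine le_trans (le_of_eq ?_) this
    rw [sum_filter]
    refine sum_congr rfl fun y _ => ?_
    unfold Close; rw [hr]; split_ifs <;> first | rfl | (exfalso; linarith)
  have htest : ∀ t, ∑ y : Fin n → ZMod 2, (if C.Test t i y then 0 else ∏ k, g k (y k))
      ≤ Real.exp (-(C.slack ^ 2 / 6) * n) := by
    intro t
    -- Off the noisy positions of the true message the error rate is exactly `p`, so the threshold
    -- is exceeded only by a deviation of `slack * n`.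
    have := sum_errs_gt_le (C.part t \ C.noisy i) (C.word i) g hg0 hg1 hs hs1
      (A := C.crossover * #(C.part t \ C.noisy i))
      (by
        simp only [hgc]
        rw [sum_congr rfl (g := fun _ => C.crossover)]
        · simp [mul_comm]
        · intro k hk
          simp [received, noise, (mem_sdiff.1 hk).2, hC])
      (by
        have : (#(C.part t \ C.noisy i) : ℝ) ≤ n := by exact_mod_cast card_finset_fin_le _
        rw [hC]
        nlinarith)
    refine le_trans (le_of_eq ?_) this
    rw [sum_filter]
    refine sum_congr rfl fun y _ => ?_
    unfold Test; split_ifs <;> first | rfl | (exfalso; linarith)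
  have hw0 : ∀ y : Fin n → ZMod 2, 0 ≤ ∏ k, g k (y k) := fun y => prod_nonneg fun k _ => hg0 _ _
  -- Rejection of `i` has three causes in some part: `y` is far from the true codeword, the test
  -- fails, or another codeword is close too. The third is the confusion term.
  have hterm : ∀ y : Fin n → ZMod 2,
      (if C.code.dec y ∈ ({some i}ᶜ : Finset (Option (Fin M))) then ∏ k, g k (y k) else 0)
      ≤ ∑ t, ((if C.Close t i y then 0 else ∏ k, g k (y k))
          + (if C.Test t i y then 0 else ∏ k, g k (y k))
          + ∑ j ∈ ({i}ᶜ : Finset (Fin M)), if C.Close t j y then ∏ k, g k (y k) else 0) := by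
    intro y
    have hw := hw0 y
    have hc : ∀ t, 0 ≤ if C.Close t i y then 0 else ∏ k, g k (y k) := fun t => by
      split_ifs; exacts [le_rfl, hw]
    have ht : ∀ t, 0 ≤ if C.Test t i y then 0 else ∏ k, g k (y k) := fun t => by
      split_ifs; exacts [le_rfl, hw]
    have hj : ∀ t, ∀ j ∈ ({i}ᶜ : Finset (Fin M)),
        0 ≤ if C.Close t j y then ∏ k, g k (y k) else 0 := fun t j _ => by
      split_ifs; exacts [hw, le_rfl]
    have hnn : ∀ t ∈ (univ : Finset κ), 0 ≤ (if C.Close t i y then 0 else ∏ k, g k (y k))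
          + (if C.Test t i y then 0 else ∏ k, g k (y k))
          + ∑ j ∈ ({i}ᶜ : Finset (Fin M)), if C.Close t j y then ∏ k, g k (y k) else 0 :=
      fun t _ => add_nonneg (add_nonneg (hc t) (ht t)) (sum_nonneg (hj t))
    split_ifs with h
    · have hna : ¬ C.Accept i y := fun ha => by
        rw [C.dec_eq_some_of_accept ha] at h
        simp at h
      unfold Accept at hna
      push Not at hna
      obtain ⟨t, ht'⟩ := hna
      refine le_trans ?_ (single_le_sum hnn (mem_univ t))
      by_cases h1 : C.Close t i y
      · by_cases h2 : C.UniqueClose t i y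
        · have h3 := ht' h2
          have := sum_nonneg (hj t)
          rw [if_neg h3]
          linarith [hc t]
        · have : ∃ j, j ≠ i ∧ C.Close t j y := by
            by_contra hcon
            push Not at hcon
            exact h2 ⟨h1, hcon⟩
          obtain ⟨j, hji, hjc⟩ := this
          have h4 := single_le_sum (hj t) (show j ∈ ({i}ᶜ : Finset (Fin M)) by simpa using hji)
          rw [if_pos hjc] at h4
          linarith [hc t, ht t]
      · have := sum_nonneg (hj t)
        rw [if_neg h1]
        linarith [ht t]
    · exact sum_nonneg hnn
  have hgoal : ∀ y : Fin n → ZMod 2, ∏ k, flip (C.received p i k) (C.word i k) (y k)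
      = ∏ k, g k (y k) := fun y => by rw [hg]
  unfold confusion
  simp only [hgoal]
  rw [sum_filter]
  refine (sum_le_sum fun y _ => hterm y).trans ?_
  rw [sum_comm]
  simp only [sum_add_distrib]
  refine add_le_add ?_ (le_of_eq (sum_congr rfl fun t _ => ?_))
  · rw [← sum_add_distrib]
    calc _ ≤ ∑ t : κ, (2 * Real.exp (-(C.slack ^ 2 / 6) * n)) :=
          sum_le_sum fun t _ => by linarith [hcl t, htest t]
      _ = _ := by rw [sum_const, nsmul_eq_mul, card_univ]
  · rw [sum_comm]
    exact sum_congr rfl fun j _ => sum_congr rfl fun y _ => if_congr Iff.rfl rfl rfl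

end CodeData

/-! ### Comparison of the two criteria and the idle adversary -/

section General

variable {X S Y Z : Type} [Fintype X] [Fintype S] [DecidableEq S] [Fintype Y] [Fintype Z] {M : ℕ}

theorem errorProb_nonneg (ch : MyopicChannel X S Y Z) (c : AuthCode X Y M n)
    (J : CondDist (Fin n → Z) (Fin n → S)) (i : Fin M) : 0 ≤ errorProb ch c J i :=
  sum_nonneg fun x _ => mul_nonneg (c.enc.nonneg i x) (add_nonneg
    (sum_nonneg fun _ _ => mul_nonneg (mul_nonneg ((ch.U.block n).nonneg _ _) (J.nonneg _ _))
      (decProb_nonneg _ _ _ _ _))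
    (sum_nonneg fun _ _ => sum_nonneg fun _ _ =>
      mul_nonneg (mul_nonneg ((ch.U.block n).nonneg _ _) (J.nonneg _ _))
      (decProb_nonneg _ _ _ _ _)))

/-- A crude bound whose role is boundedness: a real supremum over an unbounded range would default
to 0. -/
theorem errorProb_le_two (ch : MyopicChannel X S Y Z) (c : AuthCode X Y M n)
    (J : CondDist (Fin n → Z) (Fin n → S)) (i : Fin M) : errorProb ch c J i ≤ 2 := by
  have h : ∀ (D : Finset (Option (Fin M))) x s, decProb ch c D x s ≤ 1 := fun D x s => by
    linarith [decProb_add_compl ch c D x s, decProb_nonneg ch c Dᶜ x s]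
  refine (errorProb_le ch c J i (ε₀ := 1) zero_le_one ?_ fun z s => ?_).trans (by norm_num)
  · rw [← c.enc.sum_one i]
    exact sum_le_sum fun x _ => mul_le_of_le_one_right (c.enc.nonneg i x) (h _ _ _)
  · rw [one_mul]
    exact sum_le_sum fun x _ => mul_le_mul_of_nonneg_left
      (mul_le_of_le_one_right ((ch.U.block n).nonneg _ _) (h _ _ _)) (c.enc.nonneg i x)

theorem maxError_nonneg (ch : MyopicChannel X S Y Z) (c : AuthCode X Y M n)
    (J : CondDist (Fin n → Z) (Fin n → S)) : 0 ≤ maxError ch c J :=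
  Real.iSup_nonneg fun i => errorProb_nonneg ch c J i

theorem maxError_le (ch : MyopicChannel X S Y Z) (c : AuthCode X Y M n)
    (J : CondDist (Fin n → Z) (Fin n → S)) {ε : ℝ} (hε : 0 ≤ ε) (h : ∀ i, errorProb ch c J i ≤ ε) :
    maxError ch c J ≤ ε :=
  Real.iSup_le h hε

theorem avgError_nonneg (ch : MyopicChannel X S Y Z) (c : AuthCode X Y M n)
    (J : CondDist (Fin n → Z) (Fin n → S)) : 0 ≤ avgError ch c J :=
  mul_nonneg (by positivity) (sum_nonneg fun i _ => errorProb_nonneg ch c J i)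

theorem avgError_le_maxError (ch : MyopicChannel X S Y Z) (c : AuthCode X Y M n)
    (J : CondDist (Fin n → Z) (Fin n → S)) : avgError ch c J ≤ maxError ch c J := by
  unfold avgError
  rcases Nat.eq_zero_or_pos M with rfl | hM
  · simpa using maxError_nonneg ch c J
  rw [one_div, inv_mul_le_iff₀ (by exact_mod_cast hM)]
  refine (sum_le_sum fun i _ => le_ciSup (f := fun i => errorProb ch c J i)
    (Finite.bddAbove_range _) i).trans ?_
  simp [maxError]

theorem bddAbove_avgError (ch : MyopicChannel X S Y Z) (c : AuthCode X Y M n) :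
    BddAbove (Set.range fun J : CondDist (Fin n → Z) (Fin n → S) => avgError ch c J) := by
  refine ⟨2, ?_⟩
  rintro _ ⟨J, rfl⟩
  exact (avgError_le_maxError ch c J).trans
    (maxError_le ch c J (by norm_num) (errorProb_le_two ch c J))

theorem bddAbove_maxError (ch : MyopicChannel X S Y Z) (c : AuthCode X Y M n) :
    BddAbove (Set.range fun J : CondDist (Fin n → Z) (Fin n → S) => maxError ch c J) := by
  refine ⟨2, ?_⟩
  rintro _ ⟨J, rfl⟩
  exact maxError_le ch c J (by norm_num) (errorProb_le_two ch c J)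

theorem AchievableMax.achievableAvg {ch : MyopicChannel X S Y Z} {R : ℝ} (h : AchievableMax ch R) :
    AchievableAvg ch R := by
  obtain ⟨hR, c, hc⟩ := h
  refine ⟨hR, c, squeeze_zero (fun n => Real.iSup_nonneg fun J => avgError_nonneg _ _ J)
    (fun n => ?_) hc⟩
  exact ciSup_mono (bddAbove_maxError ch (c n)) fun J => avgError_le_maxError ch (c n) J

/-- The absence of the adversary, as a choice of the adversary. -/
noncomputable def idle (ch : MyopicChannel X S Y Z) (n : ℕ) :
    CondDist (Fin n → Z) (Fin n → S) where
  prob _ s := if s = fun _ => ch.s₀ then 1 else 0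
  nonneg _ s := by split_ifs <;> norm_num
  sum_one _ := by simp

theorem le_errorProb_idle (ch : MyopicChannel X S Y Z) (c : AuthCode X Y M n) (i : Fin M) :
    1 - ∑ x, c.enc.prob i x * decProb ch c {some i} x (fun _ => ch.s₀)
      ≤ errorProb ch c (idle ch n) i := by
  rw [← c.enc.sum_one i, ← sum_sub_distrib]
  refine sum_le_sum fun x _ => ?_
  have h1 : ∑ z, (ch.U.block n).prob x z * (idle ch n).prob z (fun _ => ch.s₀)
        * decProb ch c {some i}ᶜ x (fun _ => ch.s₀)
      = 1 - decProb ch c {some i} x (fun _ => ch.s₀) := by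
    rw [← sum_mul]
    simp only [idle, if_true, mul_one, (ch.U.block n).sum_one]
    linarith [decProb_add_compl ch c {some i} x (fun _ => ch.s₀)]
  rw [h1]
  have h2 : 0 ≤ ∑ s ∈ ({fun _ => ch.s₀}ᶜ : Finset (Fin n → S)), ∑ z, (ch.U.block n).prob x z
      * (idle ch n).prob z s * decProb ch c {some i, none}ᶜ x s :=
    sum_nonneg fun s _ => sum_nonneg fun z _ =>
      mul_nonneg (mul_nonneg ((ch.U.block n).nonneg _ _) ((idle ch n).nonneg _ _))
      (decProb_nonneg _ _ _ _ _)
  nlinarith [mul_nonneg (c.enc.nonneg i x) h2]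

end General

/-! ### Message counts and entropy -/

theorem numMessages_pos (R : ℝ) (n : ℕ) : 0 < numMessages R n :=
  Nat.ceil_pos.2 (by positivity)

theorem two_rpow_eq_exp (x : ℝ) : (2 : ℝ) ^ x = Real.exp (x * Real.log 2) := by
  rw [Real.rpow_def_of_pos two_pos, mul_comm]

theorem numMessages_le {R : ℝ} (hR : 0 ≤ R) (n : ℕ) :
    (numMessages R n : ℝ) ≤ 2 * Real.exp (n * (R * Real.log 2)) := by
  have h1 : (1 : ℝ) ≤ 2 ^ ((n : ℝ) * R) := Real.one_le_rpow one_le_two (by positivity)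
  have h2 := (Nat.ceil_lt_add_one (zero_le_one.trans h1)).le
  rw [← mul_assoc, ← two_rpow_eq_exp]
  unfold numMessages
  linarith

theorem le_numMessages (R : ℝ) (n : ℕ) :
    Real.exp (n * (R * Real.log 2)) ≤ numMessages R n := by
  rw [← mul_assoc, ← two_rpow_eq_exp]
  exact Nat.le_ceil _

/-- The logarithm of the likelihood ratio of a BSC(`p`), with its relation to the entropy. -/
theorem binEntropy_eq {p l : ℝ} (hp0 : 0 < p) (hp1 : p < 1) (hl : l = p / (1 - p)) :
    Real.binEntropy p = -Real.log (1 - p) - p * Real.log l ∧ Real.log (1 + l) = -Real.log (1 - p) := by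
  have h1 : (0 : ℝ) < 1 - p := by linarith
  constructor
  · rw [hl, Real.log_div hp0.ne' h1.ne', Real.binEntropy, Real.log_inv, Real.log_inv]; ring
  · have : 1 + l = (1 - p)⁻¹ := by rw [hl]; field_simp; ring
    rw [this, Real.log_inv]

/-! ### Converse by sphere packing -/

section Converse

theorem prod_flip_eq {p l : ℝ} (hp1 : p < 1) (hl : l = p / (1 - p)) (x y : Fin n → ZMod 2) :
    ∏ k, flip p (x k) (y k) = (1 - p) ^ n * l ^ errs univ x y := by
  rw [pow_errs]
  have h1 : (1 : ℝ) - p ≠ 0 := by linarith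
  have : ∀ k, flip p (x k) (y k)
      = (1 - p) * (if k ∈ (univ : Finset (Fin n)) ∧ y k ≠ x k then l else 1) := by
    intro k
    by_cases h : y k = x k
    · simp [flip, h]
    · simp [flip, h, hl]; field_simp
  simp only [this, prod_mul_distrib, prod_const, card_univ, Fintype.card_fin]

/-- The sphere packing bound on the probability of a decoding set. -/
theorem sum_flip_le {p l η : ℝ} (hp0 : 0 < p) (hp : p < 1 / 2) (hl : l = p / (1 - p))
    (hη : 0 < η) (hηp : η ≤ p) (x : Fin n → ZMod 2) (D : Finset (Fin n → ZMod 2)) :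
    ∑ y ∈ D, ∏ k, flip p (x k) (y k)
      ≤ Real.exp (-(η ^ 2 / 6) * n) + #D * ((1 - p) ^ n * l ^ ((p - η) * n)) := by
  have hl0 : 0 < l := by rw [hl]; exact div_pos hp0 (by linarith)
  have hl1 : l ≤ 1 := by rw [hl, div_le_one (by linarith)]; linarith
  have hw0 : ∀ y : Fin n → ZMod 2, 0 ≤ ∏ k, flip p (x k) (y k) := fun y =>
    prod_nonneg fun k _ => flip_nonneg hp0.le (by linarith) _ _
  have hp1 : 0 < 1 - p := by linarith
  have htail : ∑ y : Fin n → ZMod 2,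
      (if (errs univ x y : ℝ) ≤ (p - η) * n then ∏ k, flip p (x k) (y k) else 0)
      ≤ Real.exp (-(η ^ 2 / 6) * n) := by
    have := sum_mul_errs_le_le (n := n) univ univ (subset_refl _) x (fun k => flip p (x k))
      (fun k b => flip_nonneg hp0.le (by linarith) _ _) (fun _ => 1) (fun _ => zero_le_one)
      (fun _ _ _ => rfl) (fun _ => p) (fun _ => by linarith)
      (fun k => by rw [sum_flip, flip_add_one, mul_one]) hη (by linarith)
      (A := (p - η) * n) (mul_nonneg (by linarith) (by positivity))
      (mul_le_of_le_one_left (by positivity) (by linarith))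
      (by simp; linarith)
    rw [sum_congr rfl (fun y _ => one_mul _), sum_prod_eq (fun k => flip p (x k))] at this
    simpa [sum_flip] using this
  calc ∑ y ∈ D, ∏ k, flip p (x k) (y k)
      ≤ ∑ y ∈ D, ((if (errs univ x y : ℝ) ≤ (p - η) * n then ∏ k, flip p (x k) (y k) else 0)
          + (1 - p) ^ n * l ^ ((p - η) * n)) := by
        refine sum_le_sum fun y _ => ?_
        split_ifs with h
        · exact le_add_of_nonneg_right (by positivity)
        -- As `l ≤ 1`, the weight decreases with the number of errors, so beyond `(p - η) n` errors
        -- it is at most its value at that threshold.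
        · rw [zero_add, prod_flip_eq (by linarith) hl, ← Real.rpow_natCast l]
          exact mul_le_mul_of_nonneg_left
            (Real.rpow_le_rpow_of_exponent_ge hl0 hl1 (not_le.1 h).le) (by positivity)
    _ ≤ _ := by
        rw [sum_add_distrib, sum_const, nsmul_eq_mul]
        refine add_le_add (le_trans ?_ htail) le_rfl
        exact sum_le_sum_of_subset_of_nonneg (subset_univ _) fun y _ _ => by
          split_ifs; exacts [hw0 y, le_rfl]

theorem decProb_idle_eq (p q : unitInterval) {M : ℕ} (c : AuthCode (ZMod 2) (ZMod 2) M n)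
    (D : Finset (Option (Fin M))) (x : Fin n → ZMod 2) :
    decProb (mbac p q) c D x (fun _ => (mbac p q).s₀)
      = ∑ y with c.dec y ∈ D, ∏ k, flip p (x k) (y k) := by
  simp [decProb, CondDist.block, mbac, bsc, flip]

/-- A lower bound for the average error over a BSC(`p`). -/
theorem le_avgError_idle (p q : unitInterval) {l η : ℝ} (hp0 : 0 < (p : ℝ)) (hp : (p : ℝ) < 1 / 2)
    (hl : l = p / (1 - p)) (hη : 0 < η) (hηp : η ≤ p) {M : ℕ} (hM : 0 < M)
    (c : AuthCode (ZMod 2) (ZMod 2) M n) :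
    1 - Real.exp (-(η ^ 2 / 6) * n) - 2 ^ n * ((1 - p) ^ n * l ^ ((p - η) * n)) / M
      ≤ avgError (mbac p q) c (idle (mbac p q) n) := by
  have hM' : (0 : ℝ) < M := by exact_mod_cast hM
  have hl0 : 0 < l := by rw [hl]; exact div_pos hp0 (by linarith)
  have hp1 : (0 : ℝ) < 1 - p := by linarith
  obtain ⟨Q, hQ⟩ : ∃ Q, Q = (1 - (p : ℝ)) ^ n * l ^ ((p - η) * n) := ⟨_, rfl⟩
  have hQ0 : 0 ≤ Q := by rw [hQ]; positivity
  obtain ⟨E, hE⟩ : ∃ E, E = Real.exp (-(η ^ 2 / 6) * n) := ⟨_, rfl⟩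
  have h1 : ∀ i, 1 - (E + #{y | c.dec y = some i} * Q)
      ≤ errorProb (mbac p q) c (idle (mbac p q) n) i := by
    intro i
    refine le_trans ?_ (le_errorProb_idle _ c i)
    refine sub_le_sub_left ?_ _
    calc _ ≤ ∑ x, c.enc.prob i x * (E + #{y | c.dec y = some i} * Q) := by
          refine sum_le_sum fun x _ => mul_le_mul_of_nonneg_left ?_ (c.enc.nonneg i x)
          rw [decProb_idle_eq, hE, hQ]
          simpa using sum_flip_le hp0 hp hl hη hηp x ({y | c.dec y = some i} : Finset _)
      _ = _ := by rw [← sum_mul, c.enc.sum_one, one_mul]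
  have h2 : ∑ i : Fin M, #{y | c.dec y = some i} ≤ 2 ^ n := by
    rw [← card_biUnion]
    · refine (card_le_univ _).trans ?_
      simp
    · intro i _ j _ hij
      refine Finset.disjoint_left.2 fun y hy hy' => ?_
      simp only [mem_filter, mem_univ, true_and] at hy hy'
      exact hij (Option.some_injective _ (hy.symm.trans hy'))
  have h3 : (∑ i : Fin M, (#{y | c.dec y = some i} : ℝ)) ≤ 2 ^ n := by exact_mod_cast h2
  unfold avgError
  rw [← hE, ← hQ, one_div, ← div_eq_inv_mul, le_div_iff₀ hM', sub_mul, div_mul_cancel₀ _ hM'.ne']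
  refine le_trans ?_ (sum_le_sum fun i _ => h1 i)
  rw [sum_sub_distrib, sum_add_distrib, ← sum_mul]
  simp only [sum_const, card_univ, Fintype.card_fin, nsmul_eq_mul]
  nlinarith [mul_le_mul_of_nonneg_right h3 hQ0]

theorem tendsto_exp_neg_mul_nat {a : ℝ} (ha : 0 < a) :
    Tendsto (fun n : ℕ => Real.exp (-a * n)) atTop (𝓝 0) := by
  refine Real.tendsto_exp_atBot.comp ?_
  exact tendsto_natCast_atTop_atTop.const_mul_atTop_of_neg (neg_neg_of_pos ha)

theorem AchievableAvg.le_one_sub_binEntropyBits {p q : unitInterval} (hp0 : 0 < (p : ℝ))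
    (hp : (p : ℝ) < 1 / 2) {R : ℝ} (h : AchievableAvg (mbac p q) R) :
    R ≤ 1 - binEntropyBits p := by
  obtain ⟨-, c, hc⟩ := h
  by_contra! hR
  have hlog2 : 0 < Real.log 2 := Real.log_pos one_lt_two
  obtain ⟨l, hl⟩ : ∃ l : ℝ, l = p / (1 - p) := ⟨_, rfl⟩
  have hp1 : (0 : ℝ) < 1 - p := by linarith
  have hl0 : 0 < l := by rw [hl]; exact div_pos hp0 hp1
  have hl1 : l < 1 := by rw [hl, div_lt_one hp1]; linarith
  have hlogl : Real.log l < 0 := Real.log_neg hl0 hl1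
  obtain ⟨hent, -⟩ := binEntropy_eq hp0 (by linarith) hl
  -- The excess of the rate over capacity, in nats. Then `η` is chosen to cost at most half of it in
  -- the exponent, with `η ≤ p` for the lower tail bound.
  obtain ⟨G, hG⟩ : ∃ G, G = R * Real.log 2 + Real.binEntropy p - Real.log 2 := ⟨_, rfl⟩
  have hG0 : 0 < G := by
    have : (1 - binEntropyBits p) * Real.log 2 = Real.log 2 - Real.binEntropy p := by
      unfold binEntropyBits; field_simp
    rw [hG]; nlinarith
  obtain ⟨η, hη⟩ : ∃ η, η = min (p : ℝ) (G / (2 * -Real.log l)) := ⟨_, rfl⟩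
  have hη0 : 0 < η := by
    rw [hη]; exact lt_min hp0 (div_pos hG0 (by linarith))
  have hηp : η ≤ p := by rw [hη]; exact min_le_left _ _
  have hηG : η * -Real.log l ≤ G / 2 := by
    have : η ≤ G / (2 * -Real.log l) := by rw [hη]; exact min_le_right _ _
    rw [le_div_iff₀ (by linarith)] at this
    linarith
  have hlow : ∀ n : ℕ, 1 - Real.exp (-(η ^ 2 / 6) * n) - Real.exp (-(G / 2) * n)
      ≤ ⨆ J, avgError (mbac p q) (c n) J := by
    intro n
    refine le_trans ?_ (le_ciSup (bddAbove_avgError (mbac p q) (c n)) (idle (mbac p q) n))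
    refine le_trans ?_ (le_avgError_idle p q hp0 hp hl hη0 hηp (numMessages_pos R n) (c n))
    refine sub_le_sub_left ?_ _
    rw [div_le_iff₀ (by exact_mod_cast numMessages_pos R n)]
    calc (2 : ℝ) ^ n * ((1 - p) ^ n * l ^ ((p - η) * n))
        = Real.exp (n * Real.log 2 + (n * Real.log (1 - p) + Real.log l * ((p - η) * n))) := by
          rw [Real.exp_add, Real.exp_add, ← Real.rpow_def_of_pos hl0, ← Real.log_pow,
            ← Real.log_pow, Real.exp_log (by positivity), Real.exp_log (by positivity)]
      _ ≤ Real.exp (-(G / 2) * n + n * (R * Real.log 2)) := by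
          rw [Real.exp_le_exp]
          have hn : (0 : ℝ) ≤ n := by positivity
          have := mul_le_mul_of_nonneg_left hηG hn
          have hG' : G = R * Real.log 2 + (-Real.log (1 - p) - p * Real.log l) - Real.log 2 := by
            rw [hG, hent]
          have h3 : n * Real.log 2 + (n * Real.log (1 - p) + Real.log l * ((p - η) * n))
              = n * (R * Real.log 2) - n * G + n * (η * -Real.log l) := by rw [hG']; ring
          rw [h3]; linarith
      _ ≤ _ := by
          rw [Real.exp_add]
          exact mul_le_mul_of_nonneg_left (le_numMessages R n) (Real.exp_pos _).le
  have hlim : Tendsto (fun n : ℕ => 1 - Real.exp (-(η ^ 2 / 6) * n) - Real.exp (-(G / 2) * n))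
      atTop (𝓝 (1 - 0 - 0)) :=
    (tendsto_const_nhds.sub (tendsto_exp_neg_mul_nat (by positivity))).sub
      (tendsto_exp_neg_mul_nat (by positivity))
  have := le_of_tendsto_of_tendsto' hlim hc hlow
  norm_num at this

end Converse

/-! ### Achievability: parts, expurgated codes and choice of constants -/

section Achievability

theorem confusion_comp_le {m m' : ℕ} {κ : Type} [Fintype κ] (T : κ → Finset (Fin n))
    (b : Fin m → Fin n → ℝ) (hb0 : ∀ i k, 0 ≤ b i k) (hb1 : ∀ i k, b i k ≤ 1) (r : ℝ)
    (u : Fin m → Fin n → ZMod 2) (e : Fin m' → Fin m) (he : Function.Injective e) (i : Fin m') :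
    confusion T (fun i => b (e i)) r (fun i => u (e i)) i ≤ confusion T b r u (e i) := by
  refine sum_le_sum fun t _ => ?_
  have hsub : ({i}ᶜ : Finset (Fin m')).image e ⊆ {e i}ᶜ := by
    intro j hj
    obtain ⟨j', hj', rfl⟩ := mem_image.1 hj
    simpa [he.eq_iff] using hj'
  refine le_trans (le_of_eq ?_) (sum_le_sum_of_subset_of_nonneg hsub fun j _ _ => ?_)
  · rw [sum_image fun _ _ _ _ h => he h]
  · refine sum_nonneg fun y _ => ?_
    split_ifs
    · exact prod_nonneg fun k _ => flip_nonneg (hb0 _ k) (hb1 _ k) _ _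
    · exact le_rfl

/-- The factor 3 counts two legitimate tail events and one undetected error for each part. -/
theorem CodeData.errorProb_code_le {M : ℕ} {κ : Type} [Fintype κ] [Nonempty κ]
    (C : CodeData n M κ) (p q : unitInterval) (hp : (p : ℝ) ≤ 1 / 2) (hq : (q : ℝ) ≤ 1 / 2)
    (hC : C.crossover = p) (hs : 0 < C.slack) (hs1 : C.slack ≤ 1 / 2)
    (hr : C.radius = (p + C.delta) * n + C.slack * n) (i : Fin M)
    (hsep : ∀ j, i ≠ j → ∃ t, 2 * C.slack * n
      ≤ (1 - 2 * (p : ℝ)) * (C.delta * q) * #(C.part t ∩ (C.noisy i \ C.noisy j)))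
    (J : CondDist (Fin n → ZMod 2) (Fin n → ZMod 2)) :
    errorProb (mbac p q) C.code J i
      ≤ 3 * Fintype.card κ * Real.exp (-(C.slack ^ 2 / 6) * n)
        + confusion (fun t => (C.part t)ᶜ) (C.received p) C.radius C.word i := by
  have h0 := C.legitimate_error_le p.2.1 hp hC hs (by linarith) hr i
  have h1 := errorProb_le (mbac p q) C.code J i
    (ε₀ := Fintype.card κ * (2 * Real.exp (-(C.slack ^ 2 / 6) * n))
        + confusion (fun t => (C.part t)ᶜ) (C.received p) C.radius C.word i)
    (ε := Fintype.card κ * Real.exp (-(C.slack ^ 2 / 6) * n)) (by positivity)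
    ((C.sum_enc_mul_decProb p q i _).trans_le (by convert h0)) fun z s => by
      rw [C.sum_enc_mul_U p q i z s, C.sum_enc_mul_U_mul_decProb p q i _ z s]
      convert C.undetected_le p q hp hq hC hs hs1 i hsep z s
  exact h1.trans_eq (by ring)

/-- The positions congruent to `t` modulo `K`. -/
def residuePart (n : ℕ) {K : ℕ} (t : Fin K) : Finset (Fin n) := {k | (k : ℕ) % K = t}

theorem card_residuePart_le {K : ℕ} (t : Fin K) : #(residuePart n t) ≤ n / K + 1 := by
  rw [← card_range (n / K + 1)]
  refine card_le_card_of_injOn (fun k => (k : ℕ) / K) (fun k _ => ?_) fun a ha b hb hab => ?_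
  · simp only [coe_range, Set.mem_Iio]
    exact Nat.lt_succ_of_le (Nat.div_le_div_right k.2.le)
  · simp only [residuePart, coe_filter, mem_univ, true_and, Set.mem_ofPred_eq] at ha hb
    ext
    rw [← Nat.div_add_mod (a : ℕ) K, ← Nat.div_add_mod (b : ℕ) K, ha, hb]
    simp only at hab
    rw [hab]

/-- Pigeonhole over residues; with `D = B i \ B j` it provides the part in which the false message
`j` is caught. -/
theorem exists_le_card_residuePart_inter {K : ℕ} (hK : 0 < K) (D : Finset (Fin n)) :
    ∃ t : Fin K, (#D : ℝ) / K ≤ #(residuePart n t ∩ D) := by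
  have hK' : (0 : ℝ) < K := by exact_mod_cast hK
  obtain ⟨t, -, ht⟩ := exists_le_card_fiber_of_nsmul_le_card_of_maps_to (M := ℝ) (s := D)
    (t := (univ : Finset (Fin K))) (f := fun k => ⟨(k : ℕ) % K, Nat.mod_lt _ hK⟩)
    (b := (#D : ℝ) / K) (fun _ _ => mem_univ _) ⟨⟨0, hK⟩, mem_univ _⟩
    (by rw [card_univ, Fintype.card_fin, nsmul_eq_mul]; field_simp; rfl)
  refine ⟨t, ht.trans_eq ?_⟩
  congr 2
  ext k
  simp [residuePart, Fin.ext_iff, and_comm]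

/-- A code of rate `R` below capacity, at a block length satisfying the stated inequalities. -/
theorem exists_authCode (p q : unitInterval) (hp : (p : ℝ) ≤ 1 / 2) (hq : (q : ℝ) ≤ 1 / 2)
    {M K : ℕ} (hK : 0 < K) {δ η c m l f ε : ℝ} (hδ : 0 ≤ δ) (hδ1 : δ ≤ 1 / 2)
    (hη : 0 < η) (hη1 : η ≤ 1 / 2) (hsep : 2 * η ≤ (1 - 2 * (p : ℝ)) * (δ * q) * (c / K))
    (hm : 0 < m) (hm1 : m ≤ 1) (hc : 0 ≤ c)
    (hpat : ((2 * M : ℕ) : ℝ) * ((n + 1) * (m ^ (-(2 * c * n)) * (1 + m) ^ n)) ≤ 2 ^ n)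
    (hl : 0 < l) (hl1 : l ≤ 1)
    (hf : ∀ t : Fin K,
      l ^ (-((p + δ) * n + η * n)) * ((1 + l) / 2) ^ #(residuePart n t)ᶜ ≤ f)
    (hε : 0 < ε) (hfε : K * ((2 * M : ℕ) * f) ≤ ε) :
    ∃ C : AuthCode (ZMod 2) (ZMod 2) M n, ∀ J i,
      errorProb (mbac p q) C J i ≤ 3 * K * Real.exp (-(η ^ 2 / 6) * n) + 2 * ε := by
  obtain ⟨B, hB⟩ := exists_patterns hm hm1 hc hpat
  have : Nonempty (Fin K) := ⟨⟨0, hK⟩⟩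
  -- The zero words are placeholders: `received` depends only on the noise patterns, which must be
  -- fixed before the codewords are drawn.
  let C₀ : CodeData n (2 * M) (Fin K) :=
    { word := fun _ _ => 0
      noisy := B
      part := residuePart n
      delta := δ
      delta_nonneg := hδ
      delta_le := hδ1
      crossover := p
      radius := (p + δ) * n + η * n
      slack := η }
  have hb0 := C₀.received_nonneg p.2.1 p.2.2
  have hb1 := C₀.received_le_one p.2.1 hp
  obtain ⟨u, e, he, hu⟩ := exists_codebook (fun t : Fin K => (residuePart n t)ᶜ) (C₀.received p)
    hb0 hb1 hl hl1 hf hε (by rwa [Fintype.card_fin])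
  let C : CodeData n M (Fin K) :=
    { word := fun i => u (e i)
      noisy := fun i => B (e i)
      part := residuePart n
      delta := δ
      delta_nonneg := hδ
      delta_le := hδ1
      crossover := p
      radius := (p + δ) * n + η * n
      slack := η }
  have hnn : 0 ≤ (1 - 2 * (p : ℝ)) * (δ * q) :=
    mul_nonneg (by linarith) (mul_nonneg hδ q.2.1)
  refine ⟨C.code, fun J i => ?_⟩
  refine (C.errorProb_code_le p q hp hq rfl hη hη1 rfl i (fun j hij => ?_) J).trans ?_
  · obtain ⟨t, ht⟩ := exists_le_card_residuePart_inter hK (B (e i) \ B (e j))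
    refine ⟨t, ?_⟩
    have h1 := hB (e i) (e j) fun h => hij (he h)
    calc 2 * η * n ≤ (1 - 2 * (p : ℝ)) * (δ * q) * (c / K) * n := by gcongr
      _ = (1 - 2 * (p : ℝ)) * (δ * q) * (c * n / K) := by ring
      _ ≤ (1 - 2 * (p : ℝ)) * (δ * q) * (#(B (e i) \ B (e j)) / K) := by gcongr
      _ ≤ _ := mul_le_mul_of_nonneg_left ht hnn
  · rw [Fintype.card_fin]
    exact add_le_add le_rfl ((confusion_comp_le _ _ hb0 hb1 _ u e he i).trans (hu i))

theorem eventually_mul_add_one_le_exp {a : ℝ} (ha : 0 < a) :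
    ∀ᶠ n : ℕ in atTop, 4 * ((n : ℝ) + 1) ≤ Real.exp (a * n) := by
  have h1 : Tendsto (fun n : ℕ => (n : ℝ) ^ 1 * Real.exp (-a * n)) atTop (𝓝 0) := by
    have := tendsto_rpow_mul_exp_neg_mul_atTop_nhds_zero 1 a ha
    simpa [Function.comp_def] using this.comp tendsto_natCast_atTop_atTop
  have h2 : Tendsto (fun n : ℕ => 4 * ((n : ℝ) ^ 1 * Real.exp (-a * n) + Real.exp (-a * n)))
      atTop (𝓝 (4 * (0 + 0))) :=
    (h1.add (tendsto_exp_neg_mul_nat ha)).const_mul 4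
  filter_upwards [h2.eventually (gt_mem_nhds (show (4 * (0 + 0) : ℝ) < 1 by norm_num))] with n hn
  have h3 : Real.exp (-a * n) * Real.exp (a * n) = 1 := by
    rw [← Real.exp_add]; simp
  have h4 := Real.exp_pos (a * n)
  calc 4 * ((n : ℝ) + 1)
      = (4 * ((n : ℝ) ^ 1 * Real.exp (-a * n) + Real.exp (-a * n))) * Real.exp (a * n) := by
        linear_combination (-4 * (n + 1 : ℝ)) * h3
    _ ≤ 1 * Real.exp (a * n) := by gcongr
    _ = _ := one_mul _

/-- Out of a gap `G`, omitting a part costs `G/4`, artificial noise `G/8` and slack `G/8`, leaving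
`G/2`. The extra position from rounding the part size costs only the constant `a`. Here `l` stands
for the negated logarithm of the likelihood ratio. -/
theorem volume_exponent_le {N x T L a p δ η G R l : ℝ} (hT : N - (x + 1) ≤ T) (hL : 0 ≤ L) (hLa : L ≤ a)
    (hx : x * L ≤ N * (G / 4)) (hδ : N * (δ * l) ≤ N * (G / 8)) (hη : N * (η * l) ≤ N * (G / 8))
    (h : N * (p * l) - N * L = -(N * G) - N * R) :
    ((p + δ) * N + η * N) * l - T * L ≤ a + N * (-(G / 2) - R) := by
  have h1 : (N - (x + 1)) * L ≤ T * L := mul_le_mul_of_nonneg_right hT hL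
  have h2 : ((p + δ) * N + η * N) * l - (N - (x + 1)) * L
      = (N * (p * l) - N * L) + N * (δ * l) + N * (η * l) + x * L + L := by ring
  linarith

theorem achievableMax_of_lt {p q : unitInterval} (hq0 : 0 < (q : ℝ)) (hqp : (q : ℝ) ≤ p)
    (hp : (p : ℝ) < 1 / 2) {R : ℝ} (hR : 0 ≤ R) (hRC : R < 1 - binEntropyBits p) :
    AchievableMax (mbac p q) R := by
  have hp0 : 0 < (p : ℝ) := hq0.trans_le hqp
  have hlog2 : 0 < Real.log 2 := Real.log_pos one_lt_two
  obtain ⟨l, hl⟩ : ∃ l : ℝ, l = p / (1 - p) := ⟨_, rfl⟩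
  have hp1 : (0 : ℝ) < 1 - p := by linarith
  have hl0 : 0 < l := by rw [hl]; exact div_pos hp0 hp1
  have hl1 : l < 1 := by rw [hl, div_lt_one hp1]; linarith
  have hlogl : 0 < -Real.log l := neg_pos.2 (Real.log_neg hl0 hl1)
  obtain ⟨hent, hlog1l⟩ := binEntropy_eq hp0 (by linarith) hl
  -- The gap to capacity in nats. All later constants depend on it but not on `n`; `η` comes last,
  -- since the surplus it must fit under involves `δ`, `c` and `K`.
  obtain ⟨G, hG⟩ : ∃ G, G = Real.log 2 - Real.binEntropy p - R * Real.log 2 := ⟨_, rfl⟩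
  have hG0 : 0 < G := by
    have : (1 - binEntropyBits p) * Real.log 2 = Real.log 2 - Real.binEntropy p := by
      unfold binEntropyBits; field_simp
    rw [hG]; nlinarith
  have hGR : G ≤ Real.log 2 - R * Real.log 2 := by
    have := Real.binEntropy_nonneg hp0.le (by linarith : (p : ℝ) ≤ 1)
    linarith
  obtain ⟨K, hK0, hK⟩ : ∃ K : ℕ, 0 < K ∧ Real.log 2 / K ≤ G / 4 := by
    obtain ⟨K, hK⟩ := exists_nat_gt (Real.log 2 / (G / 4))
    have hK0 : (0 : ℝ) < K := lt_of_le_of_lt (by positivity) hK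
    refine ⟨K, by exact_mod_cast hK0, ?_⟩
    rw [div_lt_iff₀ (by positivity)] at hK
    rw [div_le_iff₀ hK0]
    linarith
  have hK0' : (0 : ℝ) < K := by exact_mod_cast hK0
  obtain ⟨δ, hδ0, hδ1, hδ⟩ : ∃ δ : ℝ, 0 < δ ∧ δ ≤ 1 / 2 ∧ δ * -Real.log l ≤ G / 8 :=
    ⟨min (1 / 2) (G / 8 / -Real.log l), lt_min (by norm_num) (by positivity), min_le_left _ _,
      (le_div_iff₀ hlogl).1 (min_le_right _ _)⟩
  obtain ⟨m, hm0, hm1, hm⟩ : ∃ m : ℝ, 0 < m ∧ m ≤ 1 ∧ Real.log (1 + m) ≤ G / 4 := by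
    refine ⟨min 1 (G / 4), lt_min one_pos (by positivity), min_le_left _ _, ?_⟩
    have h1 : 0 < min 1 (G / 4) := lt_min one_pos (by positivity)
    have := Real.log_le_sub_one_of_pos (show 0 < 1 + min 1 (G / 4) by linarith)
    linarith [min_le_right 1 (G / 4)]
  have hlogm : 0 ≤ -Real.log m := neg_nonneg.2 (Real.log_nonpos hm0.le hm1)
  obtain ⟨c, hc0, hc⟩ : ∃ c : ℝ, 0 < c ∧ 2 * c * -Real.log m ≤ G / 4 := by
    refine ⟨G / 8 / (1 + -Real.log m), by positivity, ?_⟩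
    have h1 : G / 8 / (1 + -Real.log m) * (1 + -Real.log m) = G / 8 := by field_simp
    have h2 : 0 < G / 8 / (1 + -Real.log m) := by positivity
    linarith
  have hγ : 0 < (1 - 2 * (p : ℝ)) * (δ * q) := mul_pos (by linarith) (by positivity)
  obtain ⟨η, hη0, hη1, hηl, hηγ⟩ : ∃ η : ℝ, 0 < η ∧ η ≤ 1 / 2 ∧ η * -Real.log l ≤ G / 8 ∧
      2 * η ≤ (1 - 2 * (p : ℝ)) * (δ * q) * (c / K) := by
    refine ⟨min (min (1 / 2) (G / 8 / -Real.log l)) ((1 - 2 * (p : ℝ)) * (δ * q) * (c / K) / 2),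
      lt_min (lt_min (by norm_num) (by positivity)) (by positivity),
      (min_le_left _ _).trans (min_le_left _ _),
      (le_div_iff₀ hlogl).1 ((min_le_left _ _).trans (min_le_right _ _)), ?_⟩
    linarith [min_le_right (min (1 / 2) (G / 8 / -Real.log l))
      ((1 - 2 * (p : ℝ)) * (δ * q) * (c / K) / 2)]
  obtain ⟨err, herr⟩ : ∃ err : ℕ → ℝ, err = fun n : ℕ => 3 * K * Real.exp (-(η ^ 2 / 6) * n)
      + 2 * (8 * K * Real.exp (-(G / 2) * n)) := ⟨_, rfl⟩
  have herr0 : ∀ n, 0 ≤ err n := fun n => by rw [herr]; positivity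
  have hlim : Tendsto err atTop (𝓝 0) := by
    have h1 := ((tendsto_exp_neg_mul_nat (show 0 < η ^ 2 / 6 by positivity)).const_mul (3 * K : ℝ)).add
      (((tendsto_exp_neg_mul_nat (show 0 < G / 2 by positivity)).const_mul (8 * K : ℝ)).const_mul 2)
    rw [herr]
    simpa using h1
  have hex : ∀ᶠ n : ℕ in atTop, ∃ C : AuthCode (ZMod 2) (ZMod 2) (numMessages R n) n, ∀ J i,
      errorProb (mbac p q) C J i ≤ err n := by
    filter_upwards [eventually_mul_add_one_le_exp (show 0 < G / 2 by positivity)] with n hn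
    have hn0 : (0 : ℝ) ≤ n := by positivity
    have hM := numMessages_le hR n
    rw [herr]
    refine exists_authCode p q hp.le (by linarith) hK0 hδ0.le hδ1 hη0 hη1 hηγ hm0 hm1 hc0.le ?_
      hl0 hl1.le (f := 2 * Real.exp (n * (-(G / 2) - R * Real.log 2))) ?_ (by positivity) ?_
    -- Pattern count: `log (1 + m)` and `2 c (-log m)` use `G/4` each. The remaining `G/2` absorbs
    -- `4 (n + 1)`, where 4 comes from doubling the messages and from the ceiling.
    · have h1 : m ^ (-(2 * c * n)) * (1 + m) ^ n
          = Real.exp (n * (2 * c * -Real.log m + Real.log (1 + m))) := by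
        rw [Real.rpow_def_of_pos hm0, ← Real.exp_log (show 0 < (1 + m) ^ n by positivity),
          ← Real.exp_add, Real.log_pow]
        congr 1; ring
      have h2 : (2 : ℝ) ^ n = Real.exp (n * Real.log 2) := by
        rw [← Real.log_pow, Real.exp_log (by positivity)]
      rw [h1, h2]
      push_cast
      calc 2 * (numMessages R n : ℝ) * (((n : ℝ) + 1)
            * Real.exp (n * (2 * c * -Real.log m + Real.log (1 + m))))
          ≤ 2 * (2 * Real.exp (n * (R * Real.log 2))) * (((n : ℝ) + 1)
            * Real.exp (n * (2 * c * -Real.log m + Real.log (1 + m)))) := by gcongr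
        _ = (4 * ((n : ℝ) + 1)) * Real.exp (n * (R * Real.log 2)
              + n * (2 * c * -Real.log m + Real.log (1 + m))) := by
            rw [Real.exp_add]; ring
        _ ≤ Real.exp (G / 2 * n) * Real.exp (n * (R * Real.log 2)
              + n * (2 * c * -Real.log m + Real.log (1 + m))) := by gcongr
        _ ≤ _ := by
            rw [← Real.exp_add, Real.exp_le_exp]
            have : G / 2 + (R * Real.log 2 + (2 * c * -Real.log m + Real.log (1 + m)))
              ≤ Real.log 2 := by linarith
            nlinarith [mul_le_mul_of_nonneg_left this hn0]
    · intro t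
      have hL : 0 ≤ Real.log 2 - Real.log (1 + l) :=
        sub_nonneg.2 (Real.log_le_log (by linarith) (by linarith))
      have hL2 : Real.log 2 - Real.log (1 + l) ≤ Real.log 2 := by
        linarith [Real.log_nonneg (show 1 ≤ 1 + l by linarith)]
      have hcard : (n : ℝ) - (n / K + 1) ≤ #(residuePart n t)ᶜ := by
        have h1 : (#(residuePart n t) : ℝ) ≤ (n / K : ℕ) + 1 := by
          exact_mod_cast card_residuePart_le t
        have h2 : ((n / K : ℕ) : ℝ) ≤ n / K := Nat.cast_div_le
        have h3 : (#(residuePart n t) : ℝ) + #(residuePart n t)ᶜ = n := by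
          exact_mod_cast (card_add_card_compl (residuePart n t)).trans (Fintype.card_fin n)
        linarith
      have h1 : l ^ (-((p + δ) * n + η * n)) * ((1 + l) / 2) ^ #(residuePart n t)ᶜ
          = Real.exp (((p + δ) * n + η * n) * -Real.log l
            - #(residuePart n t)ᶜ * (Real.log 2 - Real.log (1 + l))) := by
        rw [Real.rpow_def_of_pos hl0,
          ← Real.exp_log (show 0 < ((1 + l) / 2) ^ #(residuePart n t)ᶜ by positivity),
          ← Real.exp_add, Real.log_pow, Real.log_div (by linarith) two_ne_zero]
        congr 1; ring
      have h2 : (2 : ℝ) * Real.exp (n * (-(G / 2) - R * Real.log 2))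
          = Real.exp (Real.log 2 + n * (-(G / 2) - R * Real.log 2)) := by
        rw [Real.exp_add, Real.exp_log two_pos]
      rw [h1, h2, Real.exp_le_exp]
      have h3 := mul_le_mul_of_nonneg_right hcard hL
      have h4 : (n : ℝ) / K * (Real.log 2 - Real.log (1 + l)) ≤ n * (G / 4) := by
        calc (n : ℝ) / K * (Real.log 2 - Real.log (1 + l)) ≤ n / K * Real.log 2 := by gcongr
          _ = n * (Real.log 2 / K) := by ring
          _ ≤ _ := by gcongr
      have h5 := mul_le_mul_of_nonneg_left hδ hn0
      have h6 := mul_le_mul_of_nonneg_left hηl hn0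
      have h7 : G = Real.log 2 - (Real.log (1 + l) - p * Real.log l) - R * Real.log 2 := by
        rw [hG, hent, hlog1l]
      have h8 : (n : ℝ) * (p * -Real.log l) - n * (Real.log 2 - Real.log (1 + l))
          = -(n * G) - n * (R * Real.log 2) := by rw [h7]; ring
      exact volume_exponent_le hcard hL hL2 h4 h5 h6 h8
    · push_cast
      calc (K : ℝ) * (2 * (numMessages R n : ℝ)
            * (2 * Real.exp (n * (-(G / 2) - R * Real.log 2))))
          ≤ K * (2 * (2 * Real.exp (n * (R * Real.log 2)))
            * (2 * Real.exp (n * (-(G / 2) - R * Real.log 2)))) := by gcongr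
        _ = 8 * K * (Real.exp (n * (R * Real.log 2))
            * Real.exp (n * (-(G / 2) - R * Real.log 2))) := by ring
        _ = 8 * K * Real.exp (-(G / 2) * n) := by
            rw [← Real.exp_add]; congr 2; ring
        _ ≤ _ := le_rfl
  -- Good codes are known only for large `n`; at other lengths a trivial code that always sends the
  -- zero word and always declares interference fills in.
  have hchoose : ∀ n : ℕ, ∃ C : AuthCode (ZMod 2) (ZMod 2) (numMessages R n) n,
      (∃ C' : AuthCode (ZMod 2) (ZMod 2) (numMessages R n) n, ∀ J i,
        errorProb (mbac p q) C' J i ≤ err n) → ∀ J i, errorProb (mbac p q) C J i ≤ err n := by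
    intro n
    by_cases h : ∃ C' : AuthCode (ZMod 2) (ZMod 2) (numMessages R n) n, ∀ J i,
        errorProb (mbac p q) C' J i ≤ err n
    · obtain ⟨C', hC'⟩ := h
      exact ⟨C', fun _ => hC'⟩
    · exact ⟨⟨⟨fun _ x => ∏ k, flip 0 0 (x k),
        fun _ _ => prod_nonneg fun _ _ => flip_nonneg le_rfl zero_le_one _ _,
        fun _ => by rw [sum_prod_eq (fun _ => flip 0 0)]; simp [sum_flip]⟩, fun _ => none⟩,
        fun h' => absurd h' h⟩
  choose C hC using hchoose
  refine ⟨hR, C, squeeze_zero' (Eventually.of_forall fun n =>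
    Real.iSup_nonneg fun J => maxError_nonneg _ _ J) ?_ hlim⟩
  filter_upwards [hex] with n hn
  exact Real.iSup_le (fun J => maxError_le _ _ _ (herr0 n) (hC n hn J)) (herr0 n)

end Achievability

/-- Only nonnegative rates are available, so a bound below `C` is beaten by a rate between its
maximum with 0 and `C`; this interval is nonempty because `C > 0`. -/
theorem isLUB_of_forall_lt {A : Set ℝ} {C : ℝ} (hC : 0 < C) (hle : ∀ R ∈ A, R ≤ C)
    (hlt : ∀ R, 0 ≤ R → R < C → R ∈ A) : IsLUB A C := by
  refine ⟨hle, fun b hb => le_of_forall_lt fun R hR => ?_⟩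
  obtain ⟨R', hR', hR'C⟩ := exists_between (max_lt hR hC)
  exact ((le_max_left _ _).trans_lt hR').trans_le
    (hb (hlt R' ((le_max_right _ _).trans hR'.le) hR'C))

end MyopicAuth

theorem theorem7 (p q : unitInterval) (hq : 0 < (q : ℝ)) (hqp : (q : ℝ) ≤ (p : ℝ))
    (hp : (p : ℝ) < 1 / 2) :
    MyopicAuth.IsAuthCapacityAvg (MyopicAuth.mbac p q)
        (1 - MyopicAuth.binEntropyBits (p : ℝ)) ∧
      MyopicAuth.IsAuthCapacityMax (MyopicAuth.mbac p q)
        (1 - MyopicAuth.binEntropyBits (p : ℝ)) := by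
  have hp0 : 0 < (p : ℝ) := hq.trans_le hqp
  have hC : 0 < 1 - MyopicAuth.binEntropyBits (p : ℝ) := by
    have h : Real.binEntropy p < Real.log 2 := Real.binEntropy_lt_log_two.2 (by
      rw [← one_div]; exact hp.ne)
    unfold MyopicAuth.binEntropyBits
    rw [sub_pos, div_lt_one (Real.log_pos one_lt_two)]
    exact h
  constructor
  · exact MyopicAuth.isLUB_of_forall_lt hC
      (fun R hR => MyopicAuth.AchievableAvg.le_one_sub_binEntropyBits hp0 hp hR)
      fun R hR0 hR => (MyopicAuth.achievableMax_of_lt hq hqp hp hR0 hR).achievableAvg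
  · exact MyopicAuth.isLUB_of_forall_lt hC
      (fun R hR => MyopicAuth.AchievableAvg.le_one_sub_binEntropyBits hp0 hp
        (MyopicAuth.AchievableMax.achievableAvg hR))
      fun R hR0 hR => MyopicAuth.achievableMax_of_lt hq hqp hp hR0 hR
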